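/- Let $\mathcal F$ be an ordinary differential field of characteristic $0$ with derivation $\delta$, and let $\mathcal E$ be a universal differential extension field of $\mathcal F$. Let $\mathcal F[\delta]$ be the Ore ring of linear differential operators ($\delta c=c\,\delta+\delta(c)$ for $c\in\mathcal F$), and let $F=L_1(x)+L_2(y)+a\in\mathcal F\{x,y\}\setminus\mathcal F$ with $L_1,L_2\in\mathcal F[\delta]$ and $a\in\mathcal F$. Let $\operatorname{sat}(F)=[F]:(S_FI_F)^\infty$ be the saturation ideal of $F$ ($S_F$ and $I_F$ are the separant and the initial of $F$ under any fixed ranking), and let $(\mathcal C,F)$ denote the differential curve $\mathcal C=\mathbb V(\operatorname{sat}(F))\subset\mathcal E^2$. A differential rational parametrization of $(\mathcal C,F)$ is a generic point of $\mathcal C$, i.e. a point whose ideal of vanishing differential polynomials over $\mathcal F$ is $\operatorname{sat}(F)$, of the form $\mathcal P(u)=\bigl(\tfrac{P_1(u)}{Q_1(u)},\tfrac{P_2(u)}{Q_2(u)}\bigr)$ with $u\in\mathcal E$ differentially transcendental over $\mathcal F$, $P_i,Q_i\in\mathcal F\{u\}$, $Q_i\neq0$ and $\gcd(P_i,Q_i)=1$.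 It is proper if $\mathcal F\langle\mathcal P(u)\rangle=\mathcal F\langle u\rangle$. It is a linear differential polynomial parametrization if both coordinates are differential polynomials in $u$ over $\mathcal F$ of degree at most $1$, not both in $\mathcal F$. The curve is unirational if $F$ is irreducible and $(\mathcal C,F)$ has a differential rational parametrization. Let $\operatorname{gcld}(L_1,L_2)$ denote the monic common left divisor of highest degree of $L_1,L_2$ in $\mathcal F[\delta]$. Theorem. $(\mathcal C,F)$ is unirational if and only if $\operatorname{gcld}(L_1,L_2)=1$. Furthermore, if $(\mathcal C,F)$ is unirational, then it has a proper linear differential polynomial parametrization, and one is given explicitly as follows. Run the extended left Euclidean algorithm on $(L_1,L_2)$: start with $(R_0,A_0,B_0)=(L_1,1,0)$, $(R_1,A_1,B_1)=(L_2,0,1)$ and $i=1$; while $R_i\neq0$, increase $i$ by $1$, write $R_{i-2}=R_{i-1}Q_{i-1}+R_i$ with $\deg R_i<\deg R_{i-1}$, and put $A_i=A_{i-2}-A_{i-1}Q_{i-1}$, $B_i=B_{i-2}-B_{i-1}Q_{i-1}$; let $n$ be the final value of $i$. Then $c:=R_{n-1}\in\mathcal F\setminus\{0\}$ and, for every $u\in\mathcal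 E$ differentially transcendental over $\mathcal F$, $$\mathcal P(u)=\Bigl(A_n(u)+A_{n-1}\bigl(-\tfrac ac\bigr),\;B_n(u)+B_{n-1}\bigl(-\tfrac ac\bigr)\Bigr)$$ is a proper linear differential polynomial parametrization of $(\mathcal C,F)$. -/

import Mathlib

noncomputable section

namespace DiffAlg

open Differential

/-! ### Iterated derivatives -/

/-- The `k`-th derivative `z ↦ z^(k)` in a differential ring. -/
def der {K : Type*} [CommRing K] [Differential K] (k : ℕ) : K → K :=
  (fun z : K => z′)^[k]

/-! ### The Ore ring `F[δ]` of linear differential operators -/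

/-- Linear differential operators `∑ cᵢ δ ^ i` with coefficients (written on the left) in `F`.
As a left `F`-module this is the module of polynomials; the multiplication is the skew one given
by `δ * c = c * δ + c′`, see `DiffOp.delta_mul_ofField`. -/
def DiffOp (F : Type*) [CommRing F] : Type _ := Polynomial F

namespace DiffOp

section Basic

variable {F : Type*} [CommRing F]

instance : AddCommGroup (DiffOp F) := inferInstanceAs (AddCommGroup (Polynomial F))

/-- The polynomial with the same (left) coefficients. -/
def toPoly : DiffOp F ≃+ Polynomial F := AddEquiv.refl _

/-- The coefficient of `δ ^ i`. -/
def coeff (L : DiffOp F) (i : ℕ) : F := (toPoly L).coeff i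

/-- The degree in `δ`; the zero operator has degree `⊥`. -/
def degree (L : DiffOp F) : WithBot ℕ := (toPoly L).degree

/-- An operator is monic if its leading coefficient is `1`. -/
def Monic (L : DiffOp F) : Prop := (toPoly L).Monic

/-- The operator `c δ ^ 0` of multiplication by `c`. -/
def ofField (c : F) : DiffOp F := toPoly.symm (Polynomial.C c)

/-- The operator `δ`. -/
def delta : DiffOp F := toPoly.symm Polynomial.X

/-- The value `∑ cᵢ z^(i)` of the operator `∑ cᵢ δ ^ i` at an element `z` of a differential
`F`-algebra. -/
def apply {K : Type*} [CommRing K] [Differential K] [Algebra F K] (L : DiffOp F) (z : K) : K :=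
  (toPoly L).sum fun i c => algebraMap F K c * der i z

end Basic

section Mul

variable {F : Type*} [CommRing F] [Differential F]

/-- Left multiplication by `δ`: `∑ cᵢ δ ^ i ↦ ∑ (cᵢ δ ^ (i + 1) + cᵢ′ δ ^ i)`. -/
def deltaMul : Module.End ℤ (Polynomial F) :=
  LinearMap.mulLeft ℤ Polynomial.X + (mapCoeffs : Derivation ℤ _ (Polynomial F)).toLinearMap

/-- Left multiplication by `∑ cᵢ δ ^ i`. -/
def leftMul (p : Polynomial F) : Module.End ℤ (Polynomial F) :=
  p.sum fun i c => LinearMap.mulLeft ℤ (Polynomial.C c) * deltaMul ^ i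

instance : Mul (DiffOp F) := ⟨fun L M => toPoly.symm (leftMul (toPoly L) (toPoly M))⟩

instance : One (DiffOp F) := ⟨ofField 1⟩

theorem deltaMul_apply (q : Polynomial F) :
    deltaMul q = Polynomial.X * q + mapCoeffs q := rfl

theorem toPoly_mul (L M : DiffOp F) : toPoly (L * M) = leftMul (toPoly L) (toPoly M) := rfl

theorem leftMul_monomial (i : ℕ) (c : F) :
    leftMul (Polynomial.monomial i c) = LinearMap.mulLeft ℤ (Polynomial.C c) * deltaMul ^ i := by
  unfold leftMul
  apply Polynomial.sum_monomial_index
  ext q : 1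
  simp

theorem leftMul_add (p q : Polynomial F) : leftMul (p + q) = leftMul p + leftMul q := by
  unfold leftMul
  apply Polynomial.sum_add_index
  · intro i
    ext q : 1
    simp
  · intro i a b
    ext q : 1
    simp [add_mul]

theorem leftMul_zero : leftMul (0 : Polynomial F) = 0 := by
  simp [leftMul]

theorem leftMul_deltaMul (p : Polynomial F) : leftMul (deltaMul p) = deltaMul * leftMul p := by
  induction p using Polynomial.induction_on' with
  | add p q hp hq => rw [map_add, leftMul_add, leftMul_add, hp, hq, mul_add]
  | monomial i c =>
    rw [deltaMul_apply, Polynomial.X_mul_monomial, mapCoeffs_monomial, leftMul_add,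
      leftMul_monomial, leftMul_monomial, leftMul_monomial]
    ext q : 1
    simp only [Module.End.mul_apply, LinearMap.add_apply, LinearMap.mulLeft_apply,
      pow_succ', deltaMul_apply, Derivation.leibniz, mapCoeffs_C, smul_eq_mul]
    ring

theorem leftMul_deltaMul_pow (i : ℕ) (p : Polynomial F) :
    leftMul ((deltaMul ^ i : Module.End ℤ _) p) = deltaMul ^ i * leftMul p := by
  induction i with
  | zero => simp
  | succ i ih =>
    rw [pow_succ', Module.End.mul_apply, leftMul_deltaMul, ih, mul_assoc]

theorem leftMul_C_mul (c : F) (p : Polynomial F) :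
    leftMul (Polynomial.C c * p) = LinearMap.mulLeft ℤ (Polynomial.C c) * leftMul p := by
  induction p using Polynomial.induction_on' with
  | add p q hp hq => rw [mul_add, leftMul_add, leftMul_add, hp, hq, mul_add]
  | monomial i b =>
    rw [Polynomial.C_mul_monomial, leftMul_monomial, leftMul_monomial]
    ext q : 1
    simp

theorem leftMul_leftMul (p q : Polynomial F) :
    leftMul (leftMul p q) = leftMul p * leftMul q := by
  induction p using Polynomial.induction_on' with
  | add p r hp hr => rw [leftMul_add, LinearMap.add_apply, leftMul_add, hp, hr, add_mul]
  | monomial i b =>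
    rw [leftMul_monomial, Module.End.mul_apply, LinearMap.mulLeft_apply, leftMul_C_mul,
      leftMul_deltaMul_pow, mul_assoc]

theorem deltaMul_pow_one (i : ℕ) :
    (deltaMul ^ i : Module.End ℤ _) (1 : Polynomial F) = Polynomial.X ^ i := by
  induction i with
  | zero => simp
  | succ i ih =>
    rw [pow_succ', Module.End.mul_apply, ih, deltaMul_apply, Polynomial.X_pow_eq_monomial,
      mapCoeffs_monomial, Polynomial.X_mul_monomial]
    simp [Polynomial.X_pow_eq_monomial]

theorem leftMul_apply_one (p : Polynomial F) : leftMul p 1 = p := by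
  induction p using Polynomial.induction_on' with
  | add p r hp hr => rw [leftMul_add, LinearMap.add_apply, hp, hr]
  | monomial i b =>
    rw [leftMul_monomial, Module.End.mul_apply, deltaMul_pow_one]
    simp [Polynomial.C_mul_X_pow_eq_monomial]

theorem leftMul_one : leftMul (1 : Polynomial F) = 1 := by
  rw [← Polynomial.C_1, ← Polynomial.monomial_zero_left, leftMul_monomial]
  ext q : 1
  simp

/-- The Ore ring `F[δ]`. -/
instance : Ring (DiffOp F) where
  __ := (inferInstance : AddCommGroup (DiffOp F))
  left_distrib L M N := (leftMul (toPoly L)).map_add (toPoly M) (toPoly N)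
  right_distrib L M N := DFunLike.congr_fun (leftMul_add (toPoly L) (toPoly M)) (toPoly N)
  zero_mul L := DFunLike.congr_fun leftMul_zero (toPoly L)
  mul_zero L := (leftMul (toPoly L)).map_zero
  mul_assoc L M N := DFunLike.congr_fun (leftMul_leftMul (toPoly L) (toPoly M)) (toPoly N)
  one_mul L := DFunLike.congr_fun leftMul_one (toPoly L)
  mul_one L := leftMul_apply_one (toPoly L)

/-- The commutation rule of the Ore ring. -/
theorem delta_mul_ofField (c : F) :
    (delta : DiffOp F) * ofField c = ofField c * delta + ofField c′ := by
  apply toPoly.injective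
  rw [map_add, toPoly_mul, toPoly_mul]
  change leftMul Polynomial.X (Polynomial.C c) =
    leftMul (Polynomial.C c) Polynomial.X + Polynomial.C c′
  have h1 : leftMul (Polynomial.X : Polynomial F) = deltaMul := by
    rw [← Polynomial.monomial_one_one_eq_X, leftMul_monomial]
    ext q : 1
    simp
  have h2 : leftMul (Polynomial.C c) = LinearMap.mulLeft ℤ (Polynomial.C c) := by
    rw [← Polynomial.monomial_zero_left, leftMul_monomial]
    simp
  rw [h1, h2, LinearMap.mulLeft_apply, deltaMul_apply, mapCoeffs_C, mul_comm]

end Mul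

/-! ### Left divisors and the extended left Euclidean algorithm

In a noncommutative ring, Mathlib's `D ∣ L` means `∃ Q, L = D * Q`, that is, `D` is a left divisor
of `L`. -/

section Euclid

variable {F : Type*} [Field F] [Differential F]

/-- `G` is the greatest common left divisor `gcld(L₁, L₂)`: a common left divisor of the highest
degree, normalized to be monic. -/
structure IsGCLD (L₁ L₂ G : DiffOp F) : Prop where
  monic : G.Monic
  dvd_left : G ∣ L₁
  dvd_right : G ∣ L₂
  degree_le : ∀ D : DiffOp F, D ∣ L₁ → D ∣ L₂ → D.degree ≤ G.degree

theorem deltaMul_degree {q : Polynomial F} {k : ℕ} (hq : q.natDegree ≤ k) :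
    (deltaMul q).natDegree ≤ k + 1 ∧ (deltaMul q).coeff (k + 1) = q.coeff k := by
  have h : ∀ j, k < j → q.coeff j = 0 := fun j hj =>
    Polynomial.coeff_eq_zero_of_natDegree_lt (by omega)
  constructor
  · rw [Polynomial.natDegree_le_iff_coeff_eq_zero]
    intro j hj
    obtain ⟨j, rfl⟩ : ∃ i, j = i + 1 := ⟨j - 1, by omega⟩
    rw [deltaMul_apply, Polynomial.coeff_add, Polynomial.coeff_X_mul, coeff_mapCoeffs,
      h j (by omega), h (j + 1) (by omega)]
    simp
  · rw [deltaMul_apply, Polynomial.coeff_add, Polynomial.coeff_X_mul, coeff_mapCoeffs,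
      h (k + 1) (by omega)]
    simp

theorem deltaMul_pow_degree {q : Polynomial F} {k : ℕ} (hq : q.natDegree ≤ k) (i : ℕ) :
    ((deltaMul ^ i : Module.End ℤ _) q).natDegree ≤ k + i ∧
      ((deltaMul ^ i : Module.End ℤ _) q).coeff (k + i) = q.coeff k := by
  induction i with
  | zero => simpa using hq
  | succ i ih =>
    have := deltaMul_degree ih.1
    rw [pow_succ', Module.End.mul_apply, ← add_assoc]
    exact ⟨this.1, this.2.trans ih.2⟩

theorem leftMul_degree {p q : Polynomial F} {n k : ℕ} (hp : p.natDegree ≤ n)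
    (hq : q.natDegree ≤ k) :
    (leftMul p q).natDegree ≤ n + k ∧ (leftMul p q).coeff (n + k) = p.coeff n * q.coeff k := by
  have key : leftMul p q = ∑ i ∈ Finset.range (n + 1),
      Polynomial.C (p.coeff i) * (deltaMul ^ i : Module.End ℤ _) q := by
    conv_lhs => rw [p.as_sum_range_C_mul_X_pow' (Nat.lt_succ_of_le hp)]
    have : ∀ s : Finset ℕ, leftMul (∑ i ∈ s, Polynomial.C (p.coeff i) * Polynomial.X ^ i) q =
        ∑ i ∈ s, Polynomial.C (p.coeff i) * (deltaMul ^ i : Module.End ℤ _) q := by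
      intro s
      induction s using Finset.induction_on with
      | empty => simp [leftMul_zero]
      | insert i s hi ih =>
        rw [Finset.sum_insert hi, Finset.sum_insert hi, leftMul_add, LinearMap.add_apply, ih,
          Polynomial.C_mul_X_pow_eq_monomial, leftMul_monomial]
        rfl
    exact this _
  have hz : ∀ i, i < n → ∀ j, n + k ≤ j →
      ((deltaMul ^ i : Module.End ℤ _) q).coeff j = 0 := fun i hi j hj =>
    Polynomial.coeff_eq_zero_of_natDegree_lt
      (lt_of_le_of_lt (deltaMul_pow_degree hq i).1 (by omega))
  constructor
  · rw [Polynomial.natDegree_le_iff_coeff_eq_zero]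
    intro j hj
    rw [key, Polynomial.finsetSum_coeff]
    apply Finset.sum_eq_zero
    intro i hi
    have hi' := Finset.mem_range.1 hi
    rw [Polynomial.coeff_C_mul, Polynomial.coeff_eq_zero_of_natDegree_lt
      (lt_of_le_of_lt (deltaMul_pow_degree hq i).1 (by omega)), mul_zero]
  · rw [key, Polynomial.finsetSum_coeff, Finset.sum_range_succ, Finset.sum_eq_zero, zero_add,
      Polynomial.coeff_C_mul, add_comm n k, (deltaMul_pow_degree hq n).2]
    intro i hi
    rw [Polynomial.coeff_C_mul, hz i (Finset.mem_range.1 hi) _ le_rfl, mul_zero]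

/-- Left Euclidean division in `F[δ]`. -/
theorem exists_left_division (L₁ L₂ : DiffOp F) (h : L₂ ≠ 0) :
    ∃ Q : DiffOp F, (L₁ - L₂ * Q).degree < L₂.degree := by
  have h' : toPoly L₂ ≠ 0 := fun e => h (toPoly.injective (by rw [e, map_zero]))
  suffices H : ∀ n : ℕ, ∀ L₁ : DiffOp F, (toPoly L₁).natDegree ≤ n →
      ∃ Q : DiffOp F, (L₁ - L₂ * Q).degree < L₂.degree from H _ L₁ le_rfl
  intro n
  induction n using Nat.strong_induction_on with
  | _ n ih =>
    intro L₁ hn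
    by_cases hlt : L₁.degree < L₂.degree
    · exact ⟨0, by simpa using hlt⟩
    · have hle : (toPoly L₂).natDegree ≤ (toPoly L₁).natDegree :=
        Polynomial.natDegree_le_natDegree (not_lt.1 hlt)
      set m := (toPoly L₂).natDegree with hm
      set k := (toPoly L₁).natDegree with hk
      set c : F := ((toPoly L₂).coeff m)⁻¹ * (toPoly L₁).coeff k with hc
      have hb : (toPoly L₂).coeff m ≠ 0 := by
        rw [hm]
        exact Polynomial.leadingCoeff_ne_zero.2 h'
      let M : DiffOp F := toPoly.symm (Polynomial.monomial (k - m) c)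
      have hM : toPoly M = Polynomial.monomial (k - m) c := rfl
      have hd := leftMul_degree (p := toPoly L₂) (q := toPoly M) (n := m) (k := k - m) hm.symm.le
        (by rw [hM]; exact Polynomial.natDegree_monomial_le _)
      rw [← toPoly_mul, Nat.add_sub_cancel' hle, hM, Polynomial.coeff_monomial, if_pos rfl, hc,
        mul_inv_cancel_left₀ hb] at hd
      have hd1 : (toPoly (L₁ - L₂ * M)).natDegree ≤ k := by
        rw [map_sub]
        exact (Polynomial.natDegree_sub_le _ _).trans (max_le le_rfl hd.1)
      have hd2 : (toPoly (L₁ - L₂ * M)).coeff k = 0 := by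
        rw [map_sub, Polynomial.coeff_sub, hd.2, sub_self]
      rcases Nat.eq_zero_or_pos k with h0 | hpos
      · refine ⟨M, ?_⟩
        have : toPoly (L₁ - L₂ * M) = 0 := by
          rw [h0] at hd1 hd2
          rw [Polynomial.eq_C_of_natDegree_le_zero hd1, hd2, Polynomial.C_0]
        unfold degree
        rw [this, Polynomial.degree_zero]
        exact bot_lt_iff_ne_bot.2 (fun e => h' (Polynomial.degree_eq_bot.1 e))
      · have hlt' : (toPoly (L₁ - L₂ * M)).natDegree < k := by
          rcases hd1.lt_or_eq with h1 | h1
          · exact h1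
          · have h2 := hd2
            rw [← h1] at h2
            have h3 := Polynomial.leadingCoeff_eq_zero.1 h2
            rw [h3, Polynomial.natDegree_zero]
            exact hpos
        obtain ⟨Q, hQ⟩ := ih _ (lt_of_lt_of_le hlt' hn) (L₁ - L₂ * M) le_rfl
        refine ⟨M + Q, ?_⟩
        rwa [mul_add, ← sub_sub]

open Classical in
/-- The left quotient of `L₁` with respect to `L₂ ≠ 0`: the operator `Q` with
`L₁ = L₂ * Q + R` and `deg R < deg L₂`. -/
def lquo (L₁ L₂ : DiffOp F) : DiffOp F :=
  if h : L₂ = 0 then 0 else (exists_left_division L₁ L₂ h).choose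

/-- The left remainder `R` in `L₁ = L₂ * Q + R`. -/
def lrem (L₁ L₂ : DiffOp F) : DiffOp F := L₁ - L₂ * lquo L₁ L₂

theorem degree_lrem_lt (L₁ : DiffOp F) {L₂ : DiffOp F} (h : L₂ ≠ 0) :
    (lrem L₁ L₂).degree < L₂.degree := by
  rw [lrem, lquo, dif_neg h]
  exact (exists_left_division L₁ L₂ h).choose_spec

theorem mul_lquo_add_lrem (L₁ L₂ : DiffOp F) : L₂ * lquo L₁ L₂ + lrem L₁ L₂ = L₁ := by
  rw [lrem]
  abel

/-- The output `(R_{n-1}, A_n, B_n, A_{n-1}, B_{n-1})` of the extended left Euclidean algorithm. -/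
structure ELEOutput (F : Type*) [Field F] where
  /-- the last nonzero remainder `R_{n-1}` -/
  R : DiffOp F
  /-- the cofactor `A_n` -/
  A : DiffOp F
  /-- the cofactor `B_n` -/
  B : DiffOp F
  /-- the cofactor `A_{n-1}` -/
  A' : DiffOp F
  /-- the cofactor `B_{n-1}` -/
  B' : DiffOp F

open Classical in
/-- The loop of the extended left Euclidean algorithm, entered with the values
`R_{i-1}, A_{i-1}, B_{i-1}, R_i, A_i, B_i`. -/
def eleLoop (R' A' B' R A B : DiffOp F) : ELEOutput F :=
  if R = 0 then ⟨R', A, B, A', B'⟩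
  else eleLoop R A B (lrem R' R) (A' - A * lquo R' R) (B' - B * lquo R' R)
termination_by R.degree
decreasing_by exact degree_lrem_lt _ ‹_›

/-- The extended left Euclidean algorithm. -/
def ele (L₁ L₂ : DiffOp F) : ELEOutput F := eleLoop L₁ 1 0 L₂ 0 1

end Euclid

end DiffOp

/-! ### Differential polynomials -/

/-- The underlying ring of the differential polynomial ring `F{y_j : j ∈ σ}`: the variable
`(j, k)` is the derivative `y_j^(k)`. -/
abbrev DiffPoly (σ : Type*) (F : Type*) [CommRing F] := MvPolynomial (σ × ℕ) F

section DiffPoly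

variable {σ : Type*} {F : Type*} [CommRing F] [Differential F]

/-- Differentiate the coefficients of a polynomial. -/
def coeffDer (p : DiffPoly σ F) : DiffPoly σ F :=
  ∑ m ∈ p.support, MvPolynomial.monomial m (p.coeff m)′

theorem coeff_coeffDer (p : DiffPoly σ F) (m : σ × ℕ →₀ ℕ) :
    (coeffDer p).coeff m = (p.coeff m)′ := by
  classical
  unfold coeffDer
  rw [MvPolynomial.coeff_sum]
  simp only [MvPolynomial.coeff_monomial]
  rw [Finset.sum_ite_eq' p.support m]
  split_ifs with h
  · rfl
  · rw [MvPolynomial.notMem_support_iff.1 h, map_zero]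

theorem coeffDer_add (p q : DiffPoly σ F) : coeffDer (p + q) = coeffDer p + coeffDer q := by
  ext m
  simp [coeff_coeffDer]

theorem coeffDer_monomial (m : σ × ℕ →₀ ℕ) (c : F) :
    coeffDer (MvPolynomial.monomial m c) = MvPolynomial.monomial m c′ := by
  classical
  ext k
  rw [coeff_coeffDer, MvPolynomial.coeff_monomial, MvPolynomial.coeff_monomial]
  split_ifs <;> simp

theorem coeffDer_mul (p q : DiffPoly σ F) :
    coeffDer (p * q) = p * coeffDer q + q * coeffDer p := by
  induction p using MvPolynomial.induction_on' with
  | add p r hp hr => rw [add_mul, coeffDer_add, coeffDer_add, hp, hr]; ring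
  | monomial m c =>
    induction q using MvPolynomial.induction_on' with
    | add q r hq hr => rw [mul_add, coeffDer_add, coeffDer_add, hq, hr]; ring
    | monomial k b =>
      simp only [MvPolynomial.monomial_mul, coeffDer_monomial, Derivation.leibniz, smul_eq_mul,
        map_add]
      rw [add_comm k m]

/-- `coeffDer` as a derivation. -/
def coeffDerivation : Derivation ℤ (DiffPoly σ F) (DiffPoly σ F) :=
  Derivation.mk' (AddMonoidHom.mk' coeffDer coeffDer_add).toIntLinearMap
    (fun p q => coeffDer_mul p q)

/-- The differential polynomial ring: its derivation extends that of `F` and maps `y_j^(k)` to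
`y_j^(k+1)`. -/
instance : Differential (DiffPoly σ F) where
  deriv := coeffDerivation +
    (MvPolynomial.mkDerivation F fun v : σ × ℕ =>
      (MvPolynomial.X (v.1, v.2 + 1) : DiffPoly σ F)).restrictScalars ℤ

theorem deriv_X (j : σ) (k : ℕ) :
    (MvPolynomial.X (j, k) : DiffPoly σ F)′ = MvPolynomial.X (j, k + 1) := by
  change coeffDer (MvPolynomial.X (j, k)) + MvPolynomial.mkDerivation F _ _ = _
  rw [MvPolynomial.mkDerivation_X, MvPolynomial.X, coeffDer_monomial]
  simp

instance : DifferentialAlgebra F (DiffPoly σ F) where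
  deriv_algebraMap c := by
    change coeffDer (MvPolynomial.C c) + MvPolynomial.mkDerivation F _ (algebraMap F _ c) = _
    rw [Derivation.map_algebraMap, MvPolynomial.C_apply, coeffDer_monomial]
    simp [MvPolynomial.algebraMap_eq]

/-- The linear differential polynomial `L₁(x) + L₂(y) + a` in `F{x, y}`. -/
def linearDiffPoly (L₁ L₂ : DiffOp F) (a : F) : DiffPoly (Fin 2) F :=
  L₁.apply (MvPolynomial.X (0, 0)) + L₂.apply (MvPolynomial.X (1, 0)) + MvPolynomial.C a

/-- A differential ideal: an ideal closed under the derivation. -/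
def IsDiffIdeal (I : Ideal (DiffPoly σ F)) : Prop := ∀ f ∈ I, f′ ∈ I

/-- The differential ideal `[S]` generated by `S`. -/
def diffSpan (S : Set (DiffPoly σ F)) : Ideal (DiffPoly σ F) :=
  Ideal.span {g | ∃ f ∈ S, ∃ k : ℕ, g = der k f}

end DiffPoly

/-! ### Rankings and the saturation ideal -/

/-- A ranking on the derivatives `y_j^(k)`. -/
structure Ranking (σ : Type*) where
  /-- the total order -/
  order : LinearOrder (σ × ℕ)
  lt_der : ∀ v : σ × ℕ, order.lt v (v.1, v.2 + 1)
  der_lt_der : ∀ v w : σ × ℕ, order.lt v w → order.lt (v.1, v.2 + 1) (w.1, w.2 + 1)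

section Saturation

variable {σ : Type*} {F : Type*} [CommRing F]

/-- The leader of a differential polynomial in which some derivative `y_j^(k)` appears. -/
def leader (R : Ranking σ) (A : DiffPoly σ F) (h : A.vars.Nonempty) : σ × ℕ :=
  @Finset.max' _ R.order A.vars h

/-- The coefficient of the highest power of the variable `v` in `A`, with `A` viewed as a
univariate polynomial in `v`. -/
def leadingCoeffIn (v : σ × ℕ) (A : DiffPoly σ F) : DiffPoly σ F :=
  ∑ m ∈ A.support with m v = A.degreeOf v, MvPolynomial.monomial (m.erase v) (A.coeff m)

open Classical in
/-- The product of the separant and the initial of `A` (and `1` when `A` is a constant). -/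
def sepInit (R : Ranking σ) (A : DiffPoly σ F) : DiffPoly σ F :=
  if h : A.vars.Nonempty then
    MvPolynomial.pderiv (leader R A h) A * leadingCoeffIn (leader R A h) A
  else 1

/-- The saturation ideal `sat(A) = [A] : (S_A I_A)^∞`. For irreducible `A` this is the general
component of `A`, the ideal of the differential curve `(𝒞, A)`, `𝒞 = 𝕍(sat(A))`. -/
def sat [Differential F] (R : Ranking σ) (A : DiffPoly σ F) : Ideal (DiffPoly σ F) where
  carrier := {f | ∃ m : ℕ, sepInit R A ^ m * f ∈ diffSpan {A}}
  zero_mem' := ⟨0, by simp⟩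
  add_mem' := by
    rintro f g ⟨m, hm⟩ ⟨n, hn⟩
    refine ⟨m + n, ?_⟩
    have h1 := (diffSpan {A}).mul_mem_left (sepInit R A ^ n) hm
    have h2 := (diffSpan {A}).mul_mem_left (sepInit R A ^ m) hn
    convert (diffSpan {A}).add_mem h1 h2 using 1
    ring
  smul_mem' := by
    rintro c f ⟨m, hm⟩
    refine ⟨m, ?_⟩
    convert (diffSpan {A}).mul_mem_left c hm using 1
    rw [smul_eq_mul]
    ring

end Saturation

/-! ### Points in a differential extension field -/

section Points

variable {σ : Type*} (F : Type*) {E : Type*} [Field F] [Field E] [Differential E] [Algebra F E]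

/-- Evaluation `f ↦ f(η)` of differential polynomials over `F` at a point `η`. -/
def diffEval (η : σ → E) : DiffPoly σ F →ₐ[F] E :=
  MvPolynomial.aeval fun v : σ × ℕ => der v.2 (η v.1)

/-- The ideal `𝕀(η)` of all differential polynomials over `F` that vanish at `η`. -/
def vanishingIdeal (η : σ → E) : Ideal (DiffPoly σ F) := RingHom.ker (diffEval F η)

/-- `η` is a generic point of the ideal `P` (or of the variety `𝕍(P)`). Such a `P` is
automatically a prime ideal. -/
def IsGenericPoint (P : Ideal (DiffPoly σ F)) (η : σ → E) : Prop := vanishingIdeal F η = P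

/-- `u` is differentially transcendental over `F`. -/
def DiffTranscendental (u : E) : Prop := AlgebraicIndependent F fun k : ℕ => der k u

/-- The differential field `F⟨S⟩` generated by `S` over `F`. -/
def diffAdjoin (S : Set E) : IntermediateField F E :=
  IntermediateField.adjoin F {z | ∃ s ∈ S, ∃ k : ℕ, z = der k s}

/-- The differential field structure on an intermediate field that is closed under the
derivation. -/
@[reducible]
def subDifferential {F : Type*} {E : Type*} [Field F] [Field E] [Differential E] [Algebra F E]
    (G : IntermediateField F E) (hG : ∀ z ∈ G, z′ ∈ G) : Differential G where
  deriv := Derivation.mk'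
    (AddMonoidHom.mk' (fun z : G => (⟨(z : E)′, hG z z.2⟩ : G))
      (fun a b => Subtype.ext (by simp))).toIntLinearMap
    (fun a b => Subtype.ext (by simp))

variable (E) in
/-- `E` is a universal differential extension field of `F` (of characteristic zero): for every
differential field `G` with `F ⊆ G ⊆ E` that is finitely generated over `F` as a differential
field, and every `n`, each prime differential ideal of `G{y_1, …, y_n}` has a generic zero in
`E^n`. -/
def IsUniversalExtension : Prop :=
  ∀ (G : IntermediateField F E) (hG : ∀ z ∈ G, z′ ∈ G),
    (∃ S : Set E, S.Finite ∧ G = diffAdjoin F S) →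
    letI : Differential G := subDifferential G hG
    ∀ (n : ℕ) (P : Ideal (DiffPoly (Fin n) G)), P.IsPrime → IsDiffIdeal P →
      ∃ η : Fin n → E, IsGenericPoint G P η

end Points

/-! ### Differential rational parametrizations of plane differential curves -/

section Parametrization

variable {F : Type*} {E : Type*} [Field F] [Differential F] [Field E] [Differential E]
  [Algebra F E]

/-- `η = 𝒫(u)` is a differential rational parametrization, with differential parameter `u`, of the
differential curve `(𝒞, A)`: each coordinate is a quotient `P(u) / Q(u)` of coprime differential
polynomials in one differential indeterminate over `F`, and `η` is a generic point of the curve. -/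
structure IsRationalParametrization (R : Ranking (Fin 2)) (A : DiffPoly (Fin 2) F) (u : E)
    (η : Fin 2 → E) : Prop where
  parameter : DiffTranscendental F u
  rational : ∀ i, ∃ P Q : DiffPoly Unit F, Q ≠ 0 ∧ IsRelPrime P Q ∧
    η i = diffEval F (fun _ => u) P / diffEval F (fun _ => u) Q
  generic : IsGenericPoint F (sat R A) η

variable (E) in
/-- The differential curve `(𝒞, A)` (with `A` irreducible) is unirational. -/
def IsUnirational (R : Ranking (Fin 2)) (A : DiffPoly (Fin 2) F) : Prop :=
  Irreducible A ∧ ∃ (u : E) (η : Fin 2 → E), IsRationalParametrization R A u η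

/-- A proper differential parametrization of `(𝒞, A)` by linear differential polynomials in the
parameter `u`. -/
structure IsProperLinearPolyParametrization (R : Ranking (Fin 2)) (A : DiffPoly (Fin 2) F) (u : E)
    (η : Fin 2 → E) : Prop extends IsRationalParametrization R A u η where
  proper : diffAdjoin F (Set.range η) = diffAdjoin F {u}
  linear : ∀ i, ∃ P : DiffPoly Unit F, P.totalDegree ≤ 1 ∧ η i = diffEval F (fun _ => u) P
  nonconstant : ∃ i, η i ∉ Set.range (algebraMap F E)

/-- The point `(A_n(u) + A_{n-1}(-a/c), B_n(u) + B_{n-1}(-a/c))` formed from the output of the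
extended left Euclidean algorithm. -/
def eleParametrization (T : DiffOp.ELEOutput F) (a c : F) (u : E) : Fin 2 → E :=
  ![T.A.apply u + algebraMap F E (T.A'.apply (-a / c)),
    T.B.apply u + algebraMap F E (T.B'.apply (-a / c))]

end Parametrization

end DiffAlg

end

/-! The polynomial `L₁(x) + L₂(y) + a` has total degree one, so its separant and initial are nonzero
constants and its saturation ideal is the differential ideal it generates (`sat_eq_diffSpan`). The
question is then about the row `(L₁, L₂)` over the Ore ring, which acts on every differential
`F`-algebra (`DiffOp.mul_apply`).

Sufficiency. Each division step multiplies the row on the right by an invertible 2×2 matrix over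
`F[δ]`, so in the end `(L₁, L₂) M = (R, 0)` with `M` invertible (`DiffOp.exists_isUnimodular_ele`).
Here `R` is a common left divisor, hence a nonzero constant `c` if the gcld is 1. In the coordinates
`(z, t) = M⁻¹ (x, y)` the curve is `c z + a = 0`: `z` equals `-a/c` and `t` is free. Setting `t = u`
and going back by `M` gives the stated point. It is generic
(`DiffOp.IsUnimodular.vanishingIdeal_eq`), and it is proper because `u` is recovered as a linear
differential expression in the coordinates.

Necessity. Let `L₁ = D M₁` and `L₂ = D M₂` with `D` of positive order. At a rational parametrization
the element `w = M₁(x) + M₂(y)` of `F⟨u⟩` satisfies `D w = -a`. Differentiation strictly raises the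
order in `u` of elements outside `F` (`mem_derField_of_deriv_mem`), so a solution of a linear
equation over `F` lies in `F` (`mem_range_of_apply_eq`). Thus `M₁(x) + M₂(y) - w` is a differential
polynomial over `F` that vanishes at the generic point. Its order is too low for it to lie in the
ideal of the curve (`linearDiffPoly_notMem_diffSpan`), a contradiction. -/

noncomputable section

namespace DiffAlg

open Differential

/-! ### Iterated derivatives. -/

section IteratedDerivatives

variable {K : Type*} [CommRing K] [Differential K]

theorem der_succ (k : ℕ) (z : K) : der (k + 1) z = (der k z)′ :=
  Function.iterate_succ_apply' _ _ _

theorem der_add (k : ℕ) (y z : K) : der k (y + z) = der k y + der k z := by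
  induction k with
  | zero => rfl
  | succ k ih => rw [der_succ, der_succ, der_succ, ih, map_add]

theorem der_sub (k : ℕ) (y z : K) : der k (y - z) = der k y - der k z := by
  induction k with
  | zero => rfl
  | succ k ih => rw [der_succ, der_succ, der_succ, ih, map_sub]

theorem der_zero_right (k : ℕ) : der k (0 : K) = 0 := by
  simpa using der_sub k (0 : K) 0

theorem der_algebraMap {F : Type*} [CommRing F] [Differential F] [Algebra F K]
    [DifferentialAlgebra F K] (k : ℕ) (c : F) :
    der k (algebraMap F K c) = algebraMap F K (der k c) := by
  induction k with
  | zero => rfl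
  | succ k ih => rw [der_succ, der_succ, ih, deriv_algebraMap]

theorem der_X {σ F : Type*} [CommRing F] [Differential F] (k : ℕ) (j : σ) (l : ℕ) :
    der k (MvPolynomial.X (j, l) : DiffPoly σ F) = MvPolynomial.X (j, l + k) := by
  induction k with
  | zero => rfl
  | succ k ih => rw [der_succ, ih, deriv_X, add_assoc]

end IteratedDerivatives

/-! ### The action of the Ore ring on differential algebras, and degrees. -/

namespace DiffOp

section Apply

variable {F : Type*} [CommRing F] {K : Type*} [CommRing K] [Algebra F K]

theorem toPoly_ofField (c : F) : toPoly (ofField c) = Polynomial.C c := rfl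

variable [Differential K]

theorem apply_eq_sum (L : DiffOp F) (z : K) :
    L.apply z = ∑ i ∈ (toPoly L).support, algebraMap F K (L.coeff i) * der i z := rfl

theorem apply_eq_sum_range (L : DiffOp F) (z : K) {n : ℕ} (h : (toPoly L).natDegree < n) :
    L.apply z = ∑ i ∈ Finset.range n, algebraMap F K (L.coeff i) * der i z :=
  Polynomial.sum_over_range' _ (fun i => by rw [map_zero, zero_mul]) n h

theorem apply_add (L M : DiffOp F) (z : K) : (L + M).apply z = L.apply z + M.apply z :=
  Polynomial.sum_add_index _ _ _ (fun i => by rw [map_zero, zero_mul])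
    fun i b c => by rw [map_add, add_mul]

theorem zero_apply (z : K) : (0 : DiffOp F).apply z = 0 := Polynomial.sum_zero_index _

theorem monomial_apply (i : ℕ) (c : F) (z : K) :
    (toPoly.symm (Polynomial.monomial i c)).apply z = algebraMap F K c * der i z :=
  Polynomial.sum_monomial_index _ _ (by rw [map_zero, zero_mul])

theorem ofField_apply (c : F) (z : K) : (ofField c).apply z = algebraMap F K c * z :=
  Polynomial.sum_C_index (by rw [map_zero, zero_mul])

theorem apply_map_add (L : DiffOp F) (y z : K) : L.apply (y + z) = L.apply y + L.apply z := by
  simp only [apply_eq_sum, der_add, mul_add, Finset.sum_add_distrib]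

theorem apply_map_sub (L : DiffOp F) (y z : K) : L.apply (y - z) = L.apply y - L.apply z := by
  simp only [apply_eq_sum, der_sub, mul_sub, Finset.sum_sub_distrib]

theorem apply_map_zero (L : DiffOp F) : L.apply (0 : K) = 0 := by
  simpa using apply_map_sub L (0 : K) 0

theorem one_apply (z : K) : (1 : DiffOp F).apply z = z := by
  change (ofField (1 : F)).apply z = z
  rw [ofField_apply, map_one, one_mul]

theorem delta_apply (z : K) : (delta : DiffOp F).apply z = z′ := by
  refine (Polynomial.sum_X_index (by rw [map_zero, zero_mul])).trans ?_
  rw [map_one, one_mul]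
  rfl

variable [Differential F] [DifferentialAlgebra F K]

theorem apply_algebraMap (L : DiffOp F) (c : F) :
    L.apply (algebraMap F K c) = algebraMap F K (L.apply c) := by
  simp only [apply_eq_sum, der_algebraMap, map_sum, map_mul, Algebra.algebraMap_self_apply]

/-- The two summands of `deltaMul`, the shift and the differentiated coefficients, are the two terms
of the Leibniz rule for `(c z^(i))′`. -/
theorem apply_deltaMul (p : Polynomial F) (z : K) :
    (toPoly.symm (deltaMul p)).apply z = ((toPoly.symm p).apply z)′ := by
  induction p using Polynomial.induction_on' with
  | add p q hp hq => rw [map_add, map_add, map_add, apply_add, apply_add, hp, hq, map_add]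
  | monomial i c =>
    rw [deltaMul_apply, Polynomial.X_mul_monomial, mapCoeffs_monomial, map_add, apply_add,
      monomial_apply, monomial_apply, monomial_apply, Derivation.leibniz, der_succ,
      deriv_algebraMap, smul_eq_mul, smul_eq_mul, mul_comm (der i z)]

/-- Makes every differential `F`-algebra a left `F[δ]`-module, so that identities between operators
can be evaluated at points and at the differential indeterminates alike. -/
theorem mul_apply (L M : DiffOp F) (z : K) : (L * M).apply z = L.apply (M.apply z) := by
  suffices H : ∀ p q : Polynomial F, (toPoly.symm (leftMul p q)).apply z =
      (toPoly.symm p).apply ((toPoly.symm q).apply z) from H (toPoly L) (toPoly M)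
  intro p q
  induction p using Polynomial.induction_on' with
  | add p r hp hr =>
    rw [leftMul_add, LinearMap.add_apply, map_add, map_add, apply_add, apply_add, hp, hr]
  | monomial i c =>
    have h1 : ∀ r : Polynomial F, (toPoly.symm (Polynomial.C c * r)).apply z =
        algebraMap F K c * (toPoly.symm r).apply z := by
      intro r
      induction r using Polynomial.induction_on' with
      | add p q hp hq => rw [mul_add, map_add, map_add, apply_add, apply_add, hp, hq, mul_add]
      | monomial j b =>
        rw [Polynomial.C_mul_monomial, monomial_apply, monomial_apply, map_mul, mul_assoc]
    have h2 : (toPoly.symm ((deltaMul ^ i : Module.End ℤ _) q)).apply z =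
        der i ((toPoly.symm q).apply z) := by
      induction i with
      | zero => rfl
      | succ i ih => rw [pow_succ', Module.End.mul_apply, apply_deltaMul, ih, der_succ]
    rw [leftMul_monomial, Module.End.mul_apply, LinearMap.mulLeft_apply, h1, h2]
    exact (monomial_apply i c _).symm

theorem delta_pow_apply (k : ℕ) (z : K) : ((delta : DiffOp F) ^ k).apply z = der k z := by
  induction k with
  | zero => rw [pow_zero, one_apply]; rfl
  | succ k ih => rw [pow_succ', mul_apply, ih, delta_apply, der_succ]

theorem der_apply (k : ℕ) (L : DiffOp F) (z : K) : der k (L.apply z) = (delta ^ k * L).apply z := by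
  rw [mul_apply, delta_pow_apply]

end Apply

section Degree

variable {F : Type*} [Field F]

theorem exists_eq_ofField {L : DiffOp F} (h : L.degree ≤ 0) : ∃ c, L = ofField c :=
  ⟨_, toPoly.injective (Polynomial.eq_C_of_degree_le_zero h)⟩

theorem degree_one : (1 : DiffOp F).degree = 0 := Polynomial.degree_one

variable [Differential F]

/-- Moving `δ` past a coefficient only creates terms of lower order, so leading coefficients
multiply as in a commutative polynomial ring. -/
theorem natDegree_mul (L M : DiffOp F) (hL : L ≠ 0) (hM : M ≠ 0) :
    (toPoly (L * M)).natDegree = (toPoly L).natDegree + (toPoly M).natDegree ∧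
      (toPoly (L * M)).leadingCoeff = (toPoly L).leadingCoeff * (toPoly M).leadingCoeff := by
  have h := leftMul_degree (p := toPoly L) (q := toPoly M) le_rfl le_rfl
  rw [← toPoly_mul] at h
  have hne : (toPoly L).leadingCoeff * (toPoly M).leadingCoeff ≠ 0 :=
    mul_ne_zero (Polynomial.leadingCoeff_ne_zero.2 ((map_ne_zero_iff _ toPoly.injective).2 hL))
      (Polynomial.leadingCoeff_ne_zero.2 ((map_ne_zero_iff _ toPoly.injective).2 hM))
  have h1 : (toPoly (L * M)).natDegree = (toPoly L).natDegree + (toPoly M).natDegree :=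
    le_antisymm h.1 (Polynomial.le_natDegree_of_ne_zero (by rw [h.2]; exact hne))
  exact ⟨h1, by rw [Polynomial.leadingCoeff, h1, h.2]; rfl⟩

theorem delta_pow_mul_degree (k : ℕ) (L : DiffOp F) (hL : L ≠ 0) :
    (toPoly (delta ^ k * L)).natDegree = (toPoly L).natDegree + k ∧
      (toPoly (delta ^ k * L)).leadingCoeff = (toPoly L).leadingCoeff := by
  have hd : (delta : DiffOp F) ≠ 0 := fun h => Polynomial.X_ne_zero (R := F) (congrArg toPoly h)
  have hX : toPoly (delta : DiffOp F) = Polynomial.X := rfl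
  have hne : ∀ M : DiffOp F, M ≠ 0 → delta * M ≠ 0 := by
    intro M hM h
    have := (natDegree_mul delta M hd hM).1
    rw [h, map_zero, Polynomial.natDegree_zero, hX, Polynomial.natDegree_X] at this
    omega
  suffices H : delta ^ k * L ≠ 0 ∧ (toPoly (delta ^ k * L)).natDegree = (toPoly L).natDegree + k ∧
      (toPoly (delta ^ k * L)).leadingCoeff = (toPoly L).leadingCoeff from H.2
  induction k with
  | zero => simpa using hL
  | succ k ih =>
    have h := natDegree_mul delta _ hd ih.1
    rw [hX, Polynomial.natDegree_X, Polynomial.leadingCoeff_X, one_mul, ih.2.1, ih.2.2] at h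
    rw [pow_succ', mul_assoc]
    exact ⟨hne _ ih.1, by rw [h.1]; ring, h.2⟩

theorem ofField_mul_ofField (b c : F) : ofField b * ofField c = ofField (b * c) := by
  apply toPoly.injective
  rw [toPoly_mul, toPoly_ofField, toPoly_ofField, toPoly_ofField, ← Polynomial.monomial_zero_left,
    leftMul_monomial]
  simp

end Degree

end DiffOp

/-! ### Differential polynomials of degree at most one and their saturation ideals. -/

section LinearPolynomials

variable {σ : Type*} {F : Type*} [CommRing F] [Differential F]

theorem aeval_apply_X {K : Type*} [CommRing K] [Algebra F K] (s : σ × ℕ → K) (L : DiffOp F)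
    (j : σ) : MvPolynomial.aeval s (L.apply (MvPolynomial.X (j, 0) : DiffPoly σ F)) =
      ∑ i ∈ (DiffOp.toPoly L).support, algebraMap F K (L.coeff i) * s (j, i) := by
  simp only [DiffOp.apply_eq_sum, der_X, map_sum, map_mul, AlgHom.commutes, MvPolynomial.aeval_X,
    zero_add]

theorem aeval_der_apply_X {K : Type*} [CommRing K] [Differential K] [Algebra F K] (η : σ → K)
    (L : DiffOp F) (j : σ) :
    MvPolynomial.aeval (fun v : σ × ℕ => der v.2 (η v.1))
      (L.apply (MvPolynomial.X (j, 0) : DiffPoly σ F)) = L.apply (η j) := by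
  rw [aeval_apply_X]
  rfl

theorem totalDegree_apply_X_le (L : DiffOp F) (j : σ) :
    (L.apply (MvPolynomial.X (j, 0) : DiffPoly σ F)).totalDegree ≤ 1 := by
  rw [DiffOp.apply_eq_sum]
  refine MvPolynomial.totalDegree_finsetSum_le fun i _ => ?_
  rw [der_X, MvPolynomial.algebraMap_eq, MvPolynomial.X, MvPolynomial.C_mul_monomial]
  exact (MvPolynomial.totalDegree_monomial_le _ _).trans (by simp)

theorem totalDegree_linearDiffPoly_le (L₁ L₂ : DiffOp F) (a : F) :
    (linearDiffPoly L₁ L₂ a).totalDegree ≤ 1 := by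
  refine (MvPolynomial.totalDegree_add _ _).trans (max_le
    ((MvPolynomial.totalDegree_add _ _).trans (max_le ?_ ?_)) ?_)
  · exact totalDegree_apply_X_le _ _
  · exact totalDegree_apply_X_le _ _
  · simp

theorem der_linearDiffPoly (k : ℕ) (L₁ L₂ : DiffOp F) (a : F) :
    der k (linearDiffPoly L₁ L₂ a) =
      linearDiffPoly (DiffOp.delta ^ k * L₁) (DiffOp.delta ^ k * L₂) (der k a) := by
  rw [linearDiffPoly, linearDiffPoly, der_add, der_add, DiffOp.der_apply, DiffOp.der_apply,
    ← MvPolynomial.algebraMap_eq, der_algebraMap]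

theorem der_apply_mem_diffSpan (k : ℕ) (L : DiffOp F) (A : DiffPoly σ F) :
    der k (L.apply A) ∈ diffSpan {A} := by
  rw [DiffOp.der_apply, DiffOp.apply_eq_sum]
  exact Ideal.sum_mem _ fun i _ => Ideal.mul_mem_left _ _ (Ideal.subset_span ⟨A, rfl, i, rfl⟩)

/-- No compatibility of `φ` with the derivations is needed, because `[A]` is generated as an
ordinary ideal by the derivatives of `A`. The derivatives of the indeterminates may thus be given
arbitrary, unrelated values. -/
theorem map_eq_zero_of_mem_diffSpan {K : Type*} [CommRing K] [Algebra F K] {A : DiffPoly σ F}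
    (φ : DiffPoly σ F →ₐ[F] K) (hφ : ∀ k, φ (der k A) = 0) {f : DiffPoly σ F}
    (hf : f ∈ diffSpan {A}) : φ f = 0 := by
  have : diffSpan {A} ≤ RingHom.ker φ := by
    refine Ideal.span_le.2 ?_
    rintro _ ⟨g, rfl, k, rfl⟩
    exact hφ k
  exact this hf

/-- A polynomial of total degree at most one has a constant separant and a constant initial. -/
theorem isUnit_sepInit {F : Type*} [Field F] (R : Ranking σ) {A : DiffPoly σ F}
    (hA : A.totalDegree ≤ 1) : IsUnit (sepInit R A) := by
  classical
  unfold sepInit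
  split_ifs with h
  swap
  · exact isUnit_one
  set v := leader R A h with hv
  have hmem : v ∈ A.vars := @Finset.max'_mem _ R.order A.vars h
  -- In degree at most one, `v` occurs only in the monomial `v` itself: `A` is `c v` plus terms free
  -- of `v`, so the separant and the initial both equal `c`.
  have hsupp : ∀ m ∈ A.support, m v ≠ 0 → m = Finsupp.single v 1 := by
    intro m hm hmv
    have h1 : m.sum (fun _ e => e) ≤ 1 := (MvPolynomial.le_totalDegree hm).trans hA
    have h2 : m.degree ≤ 1 := by rwa [Finsupp.degree_apply]
    have h3 : Finsupp.single v 1 ≤ m := by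
      rw [Finsupp.single_le_iff]; omega
    obtain ⟨d, rfl⟩ := exists_add_of_le h3
    have h4 : d.degree = 0 := by
      rw [map_add, Finsupp.degree_single] at h2
      omega
    rw [(Finsupp.degree_eq_zero_iff d).1 h4, add_zero]
  obtain ⟨m, hm, hvm⟩ := (MvPolynomial.mem_vars_iff_mem_support v).1 hmem
  obtain rfl := hsupp m hm (Finsupp.mem_support_iff.1 hvm)
  set c := A.coeff (Finsupp.single v 1) with hc
  have hc0 : c ≠ 0 := MvPolynomial.mem_support_iff.1 hm
  have hdeg : A.degreeOf v = 1 := by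
    refine le_antisymm ((MvPolynomial.degreeOf_le_totalDegree A v).trans hA) ?_
    simpa using MvPolynomial.monomial_le_degreeOf v hm
  have h1 : MvPolynomial.pderiv v A = MvPolynomial.C c := by
    conv_lhs => rw [A.as_sum, map_sum]
    rw [Finset.sum_eq_single (Finsupp.single v 1)]
    · simp [MvPolynomial.pderiv_monomial, hc]
    · intro m hm hne
      have : m v = 0 := by_contra fun h0 => hne (hsupp m hm h0)
      simp [MvPolynomial.pderiv_monomial, this]
    · intro h0
      exact absurd hm h0
  have h2 : leadingCoeffIn v A = MvPolynomial.C c := by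
    unfold leadingCoeffIn
    have : {m ∈ A.support | m v = A.degreeOf v} = {Finsupp.single v 1} := by
      ext m
      rw [Finset.mem_filter, Finset.mem_singleton, hdeg]
      constructor
      · rintro ⟨h3, h4⟩
        exact hsupp m h3 (by omega)
      · rintro rfl
        exact ⟨hm, by simp⟩
    rw [this, Finset.sum_singleton]
    simp [hc]
  rw [h1, h2]
  exact (hc0.isUnit.map MvPolynomial.C).mul (hc0.isUnit.map MvPolynomial.C)

theorem sat_eq_diffSpan {F : Type*} [Field F] [Differential F] (R : Ranking σ) {A : DiffPoly σ F}
    (hA : A.totalDegree ≤ 1) : sat R A = diffSpan {A} := by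
  ext f
  constructor
  · rintro ⟨m, hm⟩
    exact (Ideal.unit_mul_mem_iff_mem _ ((isUnit_sepInit R hA).pow m)).1 hm
  · intro hf
    exact ⟨0, by simpa using hf⟩

theorem irreducible_of_totalDegree_le_one {τ F : Type*} [Field F] {A : MvPolynomial τ F}
    (hA : A.totalDegree ≤ 1) (h : ∀ c, A ≠ MvPolynomial.C c) : Irreducible A := by
  have h1 : A.totalDegree ≠ 0 := fun h0 => h _ (MvPolynomial.totalDegree_eq_zero_iff_eq_C.1 h0)
  refine MvPolynomial.irreducible_of_totalDegree_eq_one (by omega) fun x hx => ?_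
  refine Ne.isUnit ?_
  rintro rfl
  exact h 0 (by ext m; simpa using hx m)

end LinearPolynomials

/-! ### The order filtration of `F⟨u⟩` for differentially transcendental `u`. -/

section DerivativeTower

variable (F : Type*) {E : Type*} [Field F] [Field E] [Differential E] [Algebra F E]

/-- The field `F(u, u′, …, u^(n-1))`. -/
def derField (u : E) (n : ℕ) : IntermediateField F E :=
  IntermediateField.adjoin F ((fun k => der k u) '' Set.Iio n)

variable {F} {u : E}

theorem der_mem_derField {k n : ℕ} (h : k < n) : der k u ∈ derField F u n :=
  IntermediateField.subset_adjoin _ _ ⟨k, h, rfl⟩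

theorem derField_mono {m n : ℕ} (h : m ≤ n) : derField F u m ≤ derField F u n :=
  IntermediateField.adjoin.mono _ _ _ (Set.image_mono (Set.Iio_subset_Iio h))

theorem derField_zero : derField F u 0 = ⊥ := by
  have : Set.Iio 0 = (∅ : Set ℕ) := by simp
  rw [derField, this, Set.image_empty, IntermediateField.adjoin_empty]

theorem mem_derField_succ {n : ℕ} {w : E} (hw : w ∈ derField F u (n + 1)) :
    ∃ p q : Polynomial (derField F u n), Polynomial.aeval (der n u) q ≠ 0 ∧
      w * Polynomial.aeval (der n u) q = Polynomial.aeval (der n u) p := by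
  have h : Set.Iio (n + 1) = Set.Iio n ∪ {n} := by
    ext k
    simp only [Set.mem_Iio, Set.union_singleton, Set.mem_insert_iff]
    omega
  rw [derField, h, Set.image_union, Set.image_singleton, ← IntermediateField.adjoin_adjoin_left,
    IntermediateField.mem_restrictScalars, IntermediateField.mem_adjoin_simple_iff] at hw
  obtain ⟨p, q, rfl⟩ := hw
  -- If the denominator vanishes at `der n u`, the quotient is `0` by convention and is rewritten as
  -- `0 / 1`.
  by_cases h0 : Polynomial.aeval (der n u) q = 0
  · exact ⟨0, 1, by simp, by simp only [h0, div_zero, zero_mul, map_zero]⟩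
  · exact ⟨p, q, h0, div_mul_cancel₀ _ h0⟩

theorem exists_mem_derField_of_mem_diffAdjoin {w : E} (hw : w ∈ diffAdjoin F {u}) :
    ∃ n, w ∈ derField F u n := by
  obtain ⟨T, hT, hw⟩ := IntermediateField.exists_finset_of_mem_adjoin hw
  have h : ∃ n, (T : Set E) ⊆ (fun k => der k u) '' Set.Iio n := by
    clear hw
    induction T using Finset.cons_induction with
    | empty => exact ⟨0, by simp⟩
    | cons x T hx ih =>
      rw [Finset.coe_cons, Set.insert_subset_iff] at hT
      obtain ⟨n, hn⟩ := ih hT.2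
      obtain ⟨_, rfl, k, rfl⟩ := hT.1
      refine ⟨max n (k + 1), ?_⟩
      rw [Finset.coe_cons, Set.insert_subset_iff]
      refine ⟨⟨k, ?_, rfl⟩, hn.trans (Set.image_mono (Set.Iio_subset_Iio (le_max_left _ _)))⟩
      exact Set.mem_Iio.2 (lt_of_lt_of_le (Nat.lt_succ_self k) (le_max_right _ _))
  obtain ⟨n, hn⟩ := h
  exact ⟨n, IntermediateField.adjoin.mono _ _ _ hn hw⟩

/-- Algebraic independence gives transcendence over the ring generated by the lower derivatives, and
passing to its fraction field does not affect algebraicity. -/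
theorem transcendental_der (hu : DiffTranscendental F u) (n : ℕ) :
    Transcendental (derField F u n) (der n u) := by
  have h := AlgebraicIndependent.transcendental_adjoin hu (s := Set.Iio n) (i := n) (by simp)
  unfold derField
  open scoped IntermediateField.algebraAdjoinAdjoin in
  exact fun h' => h ((IsFractionRing.isAlgebraic_iff _ (IntermediateField.adjoin F
    ((fun k => der k u) '' Set.Iio n)) E).2 h')

theorem der_notMem_derField (hu : DiffTranscendental F u) (n : ℕ) : der n u ∉ derField F u n :=
  fun h => transcendental_der hu n
    (isAlgebraic_algebraMap (⟨der n u, h⟩ : derField F u n))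

theorem DiffTranscendental.diffEval_injective (hu : DiffTranscendental F u) :
    Function.Injective (diffEval F fun _ : Unit => u) :=
  hu.comp (fun v : Unit × ℕ => v.2) fun _ _ h => Prod.ext rfl h

theorem DiffTranscendental.notMem_range (hu : DiffTranscendental F u) (c : F) :
    algebraMap F E c ≠ u :=
  fun h => AlgebraicIndependent.transcendental hu 0 (h ▸ isAlgebraic_algebraMap c)

theorem aeval_mem_derField {n : ℕ} (p : Polynomial (derField F u n)) :
    Polynomial.aeval (der n u) p ∈ derField F u (n + 1) := by
  rw [Polynomial.aeval_eq_sum_range]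
  refine sum_mem fun i _ => ?_
  rw [Algebra.smul_def]
  exact mul_mem (derField_mono n.le_succ (p.coeff i).2)
    (pow_mem (der_mem_derField n.lt_succ_self) _)

variable [Differential F] [DifferentialAlgebra F E]

theorem deriv_mem_derField {n : ℕ} {w : E} (hw : w ∈ derField F u n) :
    w′ ∈ derField F u (n + 1) := by
  have hle : derField F u n ≤ derField F u (n + 1) := derField_mono n.le_succ
  unfold derField at hw
  induction hw using IntermediateField.adjoin_induction with
  | mem x hx =>
    obtain ⟨k, hk, rfl⟩ := hx
    have hk' := Set.mem_Iio.1 hk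
    change (der k u)′ ∈ _
    rw [← der_succ]
    exact der_mem_derField (by omega)
  | algebraMap c =>
    rw [deriv_algebraMap]
    exact IntermediateField.algebraMap_mem _ _
  | add x y hx hy hx' hy' =>
    rw [map_add]
    exact add_mem hx' hy'
  | inv x hx hx' =>
    rw [Derivation.leibniz_inv, smul_eq_mul]
    exact mul_mem (neg_mem (pow_mem (inv_mem (hle hx)) 2)) hx'
  | mul x y hx hy hx' hy' =>
    rw [Derivation.leibniz, smul_eq_mul, smul_eq_mul]
    exact add_mem (mul_mem (hle hx) hy') (mul_mem (hle hy) hx')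

/-- Chain rule: what remains after removing the `u^(n+1)` term is `p` with differentiated
coefficients, evaluated at `u^(n)`. -/
theorem deriv_aeval_sub_mem {n : ℕ} (p : Polynomial (derField F u n)) :
    (Polynomial.aeval (der n u) p)′ -
      Polynomial.aeval (der n u) (Polynomial.derivative p) * der (n + 1) u ∈
        derField F u (n + 1) := by
  induction p using Polynomial.induction_on' with
  | add p q hp hq =>
    convert add_mem hp hq using 1
    simp only [map_add]
    ring
  | monomial i c =>
    have h1 : algebraMap (derField F u n) E c = c := rfl
    have h : (Polynomial.aeval (der n u) (Polynomial.monomial i c))′ -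
        Polynomial.aeval (der n u) (Polynomial.derivative (Polynomial.monomial i c)) *
          der (n + 1) u = der n u ^ i * (c : E)′ := by
      rw [Polynomial.derivative_monomial, Polynomial.aeval_monomial, Polynomial.aeval_monomial,
        Derivation.leibniz, Derivation.leibniz_pow, ← der_succ, h1, map_mul, map_natCast, h1]
      simp only [smul_eq_mul, nsmul_eq_mul]
      ring
    rw [h]
    exact mul_mem (pow_mem (der_mem_derField n.lt_succ_self) _) (deriv_mem_derField c.2)

/-- Differentiation raises the order of the elements of `F⟨u⟩` outside `F`. -/
theorem mem_derField_of_deriv_mem [CharZero F] (hu : DiffTranscendental F u) {n : ℕ} {w : E}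
    (hw : w ∈ derField F u (n + 1)) (hw' : w′ ∈ derField F u (n + 1)) : w ∈ derField F u n := by
  have htr := transcendental_iff_injective.1 (transcendental_der hu n)
  -- Differentiating `w q = p` gives an equation linear in `u^(n+1)` with the other terms in `F(u,
  -- …, u^(n))`. The coefficient of `u^(n+1)` must vanish, since otherwise `u^(n+1)` would lie in
  -- that field.
  have hdiff : ∀ p q : Polynomial (derField F u n),
      w * Polynomial.aeval (der n u) q = Polynomial.aeval (der n u) p →
      w * Polynomial.aeval (der n u) (Polynomial.derivative q) =
        Polynomial.aeval (der n u) (Polynomial.derivative p) := by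
    intro p q h
    by_contra hne
    refine der_notMem_derField hu (n + 1) ?_
    have h1 := congrArg (fun z : E => z′) h
    simp only [Derivation.leibniz, smul_eq_mul] at h1
    set q' := Polynomial.aeval (der n u) (Polynomial.derivative q)
    set p' := Polynomial.aeval (der n u) (Polynomial.derivative p)
    have h2 : der (n + 1) u = ((((Polynomial.aeval (der n u) p)′ - p' * der (n + 1) u) -
        w * ((Polynomial.aeval (der n u) q)′ - q' * der (n + 1) u)) -
          Polynomial.aeval (der n u) q * w′) / (w * q' - p') := by
      rw [eq_div_iff (sub_ne_zero.2 hne), ← h1]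
      ring
    rw [h2]
    exact div_mem (sub_mem (sub_mem (deriv_aeval_sub_mem p) (mul_mem hw (deriv_aeval_sub_mem q)))
      (mul_mem (aeval_mem_derField q) hw'))
      (sub_mem (mul_mem hw (aeval_mem_derField _)) (aeval_mem_derField _))
  obtain ⟨p, q, hq, h⟩ := mem_derField_succ hw
  have hq0 : q ≠ 0 := fun h0 => hq (by rw [h0, map_zero])
  clear hq
  -- By `hdiff`, `w` is also the quotient of the derivatives of `p` and `q`. Descend on the degree
  -- of the denominator until it is constant; then, in characteristic zero, the numerator is
  -- constant too.
  induction hd : q.natDegree using Nat.strong_induction_on generalizing p q with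
  | _ d ih =>
    by_cases hq' : Polynomial.derivative q = 0
    · have h1 := hdiff p q h
      rw [hq', map_zero, mul_zero, eq_comm, map_eq_zero_iff _ htr] at h1
      obtain ⟨b, rfl⟩ : ∃ b, q = Polynomial.C b :=
        ⟨_, Polynomial.eq_C_of_natDegree_eq_zero
          (Polynomial.derivative_eq_zero.1 hq')⟩
      obtain ⟨c, rfl⟩ : ∃ c, p = Polynomial.C c :=
        ⟨_, Polynomial.eq_C_of_natDegree_eq_zero
          (Polynomial.derivative_eq_zero.1 h1)⟩
      have hb : (b : E) ≠ 0 := fun hb => hq0 (by rw [ZeroMemClass.coe_eq_zero.1 hb, map_zero])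
      rw [Polynomial.aeval_C, Polynomial.aeval_C] at h
      rw [(eq_div_iff hb).2 h]
      exact div_mem c.2 b.2
    · have hlt : (Polynomial.derivative q).natDegree < d := by
        rw [← hd]
        exact Polynomial.natDegree_derivative_lt fun h0 => hq' (by
          rw [Polynomial.eq_C_of_natDegree_eq_zero h0, Polynomial.derivative_C])
      exact ih _ hlt _ _ (hdiff p q h) hq' rfl

/-- An element of `F⟨u⟩` that solves a nontrivial linear differential equation over `F` lies
in `F`. -/
theorem mem_range_of_apply_eq [CharZero F] (hu : DiffTranscendental F u) {w : E}
    (hw : w ∈ diffAdjoin F {u}) {D : DiffOp F} (hD : D ≠ 0) {b : F}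
    (h : D.apply w = algebraMap F E b) : ∃ c, algebraMap F E c = w := by
  classical
  have hex := exists_mem_derField_of_mem_diffAdjoin hw
  rcases hn : Nat.find hex with _ | n
  · have := Nat.find_spec hex
    rwa [hn, derField_zero, IntermediateField.mem_bot] at this
  · exfalso
    have hmem : w ∈ derField F u (n + 1) := by
      have := Nat.find_spec hex
      rwa [hn] at this
    have hnot : w ∉ derField F u n := Nat.find_min hex (by omega)
    -- With `w` of exact order `n`, each differentiation raises the order by exactly one.
    have hder : ∀ k, der k w ∈ derField F u (n + k + 1) ∧ der k w ∉ derField F u (n + k) := by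
      intro k
      induction k with
      | zero => exact ⟨hmem, hnot⟩
      | succ k ih =>
        rw [der_succ]
        exact ⟨deriv_mem_derField ih.1, fun h' => ih.2 (mem_derField_of_deriv_mem hu ih.1 h')⟩
    set d := (DiffOp.toPoly D).natDegree with hd
    have hlc : algebraMap F E (D.coeff d) ≠ 0 := by
      rw [Ne, map_eq_zero]
      exact Polynomial.leadingCoeff_ne_zero.2
        ((map_ne_zero_iff _ DiffOp.toPoly.injective).2 hD)
    -- The equation expresses the top derivative of `w` through lower ones, whose order is too
    -- small.
    refine (hder d).2 ?_
    rw [DiffOp.apply_eq_sum_range D w (Nat.lt_succ_self d), Finset.sum_range_succ,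
      ← eq_sub_iff_add_eq', mul_comm, ← eq_div_iff hlc] at h
    rw [h]
    refine div_mem (sub_mem (IntermediateField.algebraMap_mem _ _) (sum_mem fun i hi => ?_))
      (IntermediateField.algebraMap_mem _ _)
    have hi' := Finset.mem_range.1 hi
    exact mul_mem (IntermediateField.algebraMap_mem _ _)
      (derField_mono (by omega) (hder i).1)

end DerivativeTower

/-! ### Differential fields generated by a set, and existence of a parameter. -/

section DiffAdjoin

variable {F : Type*} {E : Type*} [Field F] [Field E] [Differential E] [Algebra F E]

theorem der_mem_diffAdjoin {S : Set E} {s : E} (hs : s ∈ S) (k : ℕ) : der k s ∈ diffAdjoin F S :=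
  IntermediateField.subset_adjoin _ _ ⟨s, hs, k, rfl⟩

theorem apply_mem_diffAdjoin {S : Set E} {s : E} (hs : s ∈ S) (L : DiffOp F) :
    L.apply s ∈ diffAdjoin F S := by
  rw [DiffOp.apply_eq_sum]
  exact sum_mem fun i _ => mul_mem (IntermediateField.algebraMap_mem _ _) (der_mem_diffAdjoin hs i)

theorem diffEval_mem_diffAdjoin {σ : Type*} (η : σ → E) (f : DiffPoly σ F) :
    diffEval F η f ∈ diffAdjoin F (Set.range η) := by
  induction f using MvPolynomial.induction_on with
  | C c => rw [diffEval, MvPolynomial.aeval_C]; exact IntermediateField.algebraMap_mem _ _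
  | add p q hp hq => rw [map_add]; exact add_mem hp hq
  | mul_X p v hp =>
    rw [map_mul]
    refine mul_mem hp ?_
    rw [diffEval, MvPolynomial.aeval_X]
    exact der_mem_diffAdjoin (Set.mem_range_self _) _

variable [Differential F] [DifferentialAlgebra F E]

theorem deriv_mem_diffAdjoin {S : Set E} {w : E} (hw : w ∈ diffAdjoin F S) :
    w′ ∈ diffAdjoin F S := by
  have hw' := hw
  unfold diffAdjoin at hw
  induction hw using IntermediateField.adjoin_induction with
  | mem x hx =>
    obtain ⟨s, hs, k, rfl⟩ := hx
    rw [← der_succ]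
    exact der_mem_diffAdjoin hs _
  | algebraMap c =>
    rw [deriv_algebraMap]
    exact IntermediateField.algebraMap_mem _ _
  | add x y hx hy hx' hy' =>
    rw [map_add]
    exact add_mem (hx' hx) (hy' hy)
  | inv x hx hx' =>
    rw [Derivation.leibniz_inv, smul_eq_mul]
    exact mul_mem (neg_mem (pow_mem (inv_mem hx) 2)) (hx' hx)
  | mul x y hx hy hx' hy' =>
    rw [Derivation.leibniz, smul_eq_mul, smul_eq_mul]
    exact add_mem (mul_mem hx (hy' hy)) (mul_mem hy (hx' hx))

theorem apply_mem_diffAdjoin_of_mem {S : Set E} {w : E} (hw : w ∈ diffAdjoin F S) (L : DiffOp F) :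
    L.apply w ∈ diffAdjoin F S := by
  have hder : ∀ k, der k w ∈ diffAdjoin F S := by
    intro k
    induction k with
    | zero => exact hw
    | succ k ih => rw [der_succ]; exact deriv_mem_diffAdjoin ih
  rw [DiffOp.apply_eq_sum]
  exact sum_mem fun i _ => mul_mem (IntermediateField.algebraMap_mem _ _) (hder i)

theorem diffAdjoin_le_of_subset {S T : Set E} (h : S ⊆ diffAdjoin F T) :
    diffAdjoin F S ≤ diffAdjoin F T := by
  refine IntermediateField.adjoin_le_iff.2 ?_
  rintro _ ⟨s, hs, k, rfl⟩
  change der k s ∈ diffAdjoin F T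
  rw [← DiffOp.delta_pow_apply (F := F)]
  exact apply_mem_diffAdjoin_of_mem (h hs) _

/-- A universal extension contains a differentially transcendental element. -/
theorem IsUniversalExtension.exists_diffTranscendental (hE : IsUniversalExtension F E) :
    ∃ u : E, DiffTranscendental F u := by
  have hbot : (⊥ : IntermediateField F E) = diffAdjoin F ∅ := by
    rw [diffAdjoin, eq_comm, ← IntermediateField.adjoin_empty]
    congr 1
    ext
    simp
  have hd : ∀ z ∈ (⊥ : IntermediateField F E), z′ ∈ (⊥ : IntermediateField F E) := by
    rw [hbot]
    exact fun z hz => deriv_mem_diffAdjoin hz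
  let := subDifferential _ hd
  -- A generic zero of the zero ideal in one indeterminate is differentially transcendental over
  -- `⊥`, the copy of `F` in `E`.
  obtain ⟨η, hη⟩ := hE ⊥ hd ⟨∅, Set.finite_empty, hbot⟩ 1 ⊥ Ideal.isPrime_bot
    (fun f hf => by rw [Ideal.mem_bot.1 hf, map_zero]; exact Ideal.zero_mem _)
  refine ⟨η 0, ?_⟩
  have h1 : AlgebraicIndependent (⊥ : IntermediateField F E)
      (fun v : Fin 1 × ℕ => der v.2 (η v.1)) :=
    (RingHom.injective_iff_ker_eq_bot _).2 hη
  have h2 : AlgebraicIndependent (⊥ : IntermediateField F E) (fun k : ℕ => der k (η 0)) :=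
    h1.comp (fun k : ℕ => ((0 : Fin 1), k)) (fun k l h => by simpa using h)
  exact h2.restrictScalars (algebraMap F (⊥ : IntermediateField F E)).injective

end DiffAdjoin

/-! ### The Euclidean algorithm as an invertible matrix over the Ore ring. -/

namespace DiffOp

variable {F : Type*} [Field F] [Differential F]

/-- The cofactor matrix `(A' A; B' B)` of the extended left Euclidean algorithm has the two-sided
inverse with the rows `(U', V')` and `(U, V)`, and `(L₁, L₂)` times the cofactor matrix is
`(R', R)`. -/
structure IsUnimodular (L₁ L₂ R' A' B' R A B U' V' U V : DiffOp F) : Prop where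
  eq_left : L₁ = R' * U' + R * U
  eq_right : L₂ = R' * V' + R * V
  inv11 : U' * A' + V' * B' = 1
  inv12 : U' * A + V' * B = 0
  inv21 : U * A' + V * B' = 0
  inv22 : U * A + V * B = 1
  mul11 : A' * U' + A * U = 1
  mul12 : A' * V' + A * V = 0
  mul21 : B' * U' + B * U = 0
  mul22 : B' * V' + B * V = 1

/-- The cofactor matrix is multiplied on the right by `(0 1; 1 -Q)` and its inverse on the left by
`(Q 1; 1 0)`; these two matrices are mutually inverse. -/
theorem IsUnimodular.step {L₁ L₂ R' A' B' R A B U' V' U V : DiffOp F}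
    (h : IsUnimodular L₁ L₂ R' A' B' R A B U' V' U V) (Q : DiffOp F) :
    IsUnimodular L₁ L₂ R A B (R' - R * Q) (A' - A * Q) (B' - B * Q)
      (U + Q * U') (V + Q * V') U' V' where
  eq_left := by rw [h.eq_left]; noncomm_ring
  eq_right := by rw [h.eq_right]; noncomm_ring
  inv11 := by
    calc _ = (U * A + V * B) + Q * (U' * A + V' * B) := by noncomm_ring
      _ = 1 := by rw [h.inv22, h.inv12]; simp
  inv12 := by
    calc _ = (U * A' + V * B') + Q * (U' * A' + V' * B') - (U * A + V * B) * Q -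
          Q * (U' * A + V' * B) * Q := by noncomm_ring
      _ = 0 := by rw [h.inv22, h.inv12, h.inv21, h.inv11]; simp
  inv21 := h.inv12
  inv22 := by
    calc _ = (U' * A' + V' * B') - (U' * A + V' * B) * Q := by noncomm_ring
      _ = 1 := by rw [h.inv11, h.inv12]; simp
  mul11 := by rw [← h.mul11]; noncomm_ring
  mul12 := by rw [← h.mul12]; noncomm_ring
  mul21 := by rw [← h.mul21]; noncomm_ring
  mul22 := by rw [← h.mul22]; noncomm_ring

theorem exists_isUnimodular_eleLoop {L₁ L₂ : DiffOp F} (R' A' B' R A B : DiffOp F)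
    {U' V' U V : DiffOp F} (h : IsUnimodular L₁ L₂ R' A' B' R A B U' V' U V) :
    ∃ X' Y' X Y, IsUnimodular L₁ L₂ (eleLoop R' A' B' R A B).R (eleLoop R' A' B' R A B).A'
      (eleLoop R' A' B' R A B).B' 0 (eleLoop R' A' B' R A B).A (eleLoop R' A' B' R A B).B
      X' Y' X Y := by
  fun_induction eleLoop R' A' B' R A B generalizing U' V' U V with
  | case1 R' A' B' A B => exact ⟨U', V', U, V, h⟩
  | case2 R' A' B' R A B hR ih => exact ih (h.step (lquo R' R))

theorem exists_isUnimodular_ele (L₁ L₂ : DiffOp F) :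
    ∃ X' Y' X Y, IsUnimodular L₁ L₂ (ele L₁ L₂).R (ele L₁ L₂).A' (ele L₁ L₂).B' 0
      (ele L₁ L₂).A (ele L₁ L₂).B X' Y' X Y :=
  -- The algorithm starts from the identity matrix.
  exists_isUnimodular_eleLoop _ _ _ _ _ _ (U' := 1) (V' := 0) (U := 0) (V := 1)
    (by constructor <;> simp)

theorem IsGCLD.exists_ele_eq_ofField {L₁ L₂ : DiffOp F} (h : IsGCLD L₁ L₂ 1)
    (h0 : L₁ ≠ 0 ∨ L₂ ≠ 0) : ∃ c, c ≠ 0 ∧ (ele L₁ L₂).R = ofField c := by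
  obtain ⟨X', Y', X, Y, hM⟩ := exists_isUnimodular_ele L₁ L₂
  have h1 := hM.eq_left
  have h2 := hM.eq_right
  rw [zero_mul, add_zero] at h1 h2
  -- With last remainder zero, `h1` and `h2` show that `R` is a common left divisor, so its degree
  -- is at most that of `1`.
  obtain ⟨c, hc⟩ := exists_eq_ofField (degree_one (F := F) ▸ h.degree_le _ ⟨_, h1⟩ ⟨_, h2⟩)
  refine ⟨c, ?_, hc⟩
  rintro rfl
  have : (ele L₁ L₂).R = 0 := hc.trans (toPoly.injective Polynomial.C_0)
  rw [this, zero_mul] at h1 h2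
  exact h0.elim (fun h => h h1) (fun h => h h2)

/-- The system is triangular: equation `k` has top index `n + k` with nonzero coefficient, so it
determines `s (n + k)` from the earlier values, while the first `n` values stay free. -/
theorem exists_sum_coeff_mul_eq (L : ℕ → DiffOp F) (n : ℕ)
    (hdeg : ∀ k, (toPoly (L k)).natDegree = n + k) (hne : ∀ k, L k ≠ 0) (b s₀ : ℕ → F) :
    ∃ s : ℕ → F, (∀ i < n, s i = s₀ i) ∧
      ∀ k, ∑ i ∈ (toPoly (L k)).support, (L k).coeff i * s i = b k := by
  let s : ℕ → F := fun m => Nat.strongRec (motive := fun _ => F) (fun m ih =>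
    if m < n then s₀ m else ((L (m - n)).coeff m)⁻¹ * (b (m - n) -
      ∑ i : Fin m, (L (m - n)).coeff i * ih i i.2)) m
  have hs : ∀ m, s m = if m < n then s₀ m else ((L (m - n)).coeff m)⁻¹ * (b (m - n) -
      ∑ i : Fin m, (L (m - n)).coeff i * s i) := fun m => Nat.strongRec_eq _ _
  refine ⟨s, fun i hi => by rw [hs, if_pos hi], fun k => ?_⟩
  have hlc : (L k).coeff (n + k) ≠ 0 := by
    rw [← hdeg k]
    exact Polynomial.leadingCoeff_ne_zero.2 ((map_ne_zero_iff _ toPoly.injective).2 (hne k))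
  have h1 : ∑ i ∈ (toPoly (L k)).support, (L k).coeff i * s i =
      ∑ i ∈ Finset.range (n + k + 1), (L k).coeff i * s i :=
    Polynomial.sum_over_range' (toPoly (L k)) (f := fun i c => c * s i) (fun i => zero_mul _) _
      (by rw [hdeg]; omega)
  rw [h1, Finset.sum_range_succ, hs (n + k), if_neg (by omega), Nat.add_sub_cancel_left,
    mul_inv_cancel_left₀ hlc, Finset.sum_range fun i => (L k).coeff i * s i]
  ring

end DiffOp

/-! ### Low-order elements outside the differential ideal. -/

section Membership

variable {F : Type*} [Field F] [Differential F]

theorem aeval_linearDiffPoly (s : Fin 2 × ℕ → F) (L₁ L₂ : DiffOp F) (a : F) :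
    MvPolynomial.aeval s (linearDiffPoly L₁ L₂ a) =
      ∑ i ∈ (DiffOp.toPoly L₁).support, L₁.coeff i * s (0, i) +
        ∑ i ∈ (DiffOp.toPoly L₂).support, L₂.coeff i * s (1, i) + a := by
  rw [linearDiffPoly, map_add, map_add, aeval_apply_X, aeval_apply_X, MvPolynomial.aeval_C]
  rfl

/-- If `D` has positive order, then `M₁(x) + M₂(y) + b` does not lie in the differential ideal
generated by `(D M₁)(x) + (D M₂)(y) + a`. -/
theorem linearDiffPoly_notMem_diffSpan {D M₁ M₂ : DiffOp F} (hD : 0 < D.degree)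
    (hM : M₁ ≠ 0 ∨ M₂ ≠ 0) (a b : F) :
    linearDiffPoly M₁ M₂ b ∉ diffSpan {linearDiffPoly (D * M₁) (D * M₂) a} := by
  classical
  have hD0 : D ≠ 0 := by
    rintro rfl
    exact absurd hD (by rw [DiffOp.degree, map_zero, Polynomial.degree_zero]; simp)
  have hDn : 0 < (DiffOp.toPoly D).natDegree := Polynomial.natDegree_pos_iff_degree_pos.2 hD
  have hmul : ∀ M : DiffOp F, M ≠ 0 → D * M ≠ 0 ∧
      (DiffOp.toPoly M).natDegree < (DiffOp.toPoly (D * M)).natDegree := by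
    intro M hM
    have h := (DiffOp.natDegree_mul D M hD0 hM).1
    refine ⟨fun h0 => ?_, by omega⟩
    rw [h0, map_zero, Polynomial.natDegree_zero] at h
    omega
  -- Values for the derivatives of one indeterminate that annihilate all derivatives of the
  -- generator but not the given polynomial.
  have key : ∀ M : DiffOp F, M ≠ 0 → ∃ s : ℕ → F,
      ∑ i ∈ (DiffOp.toPoly M).support, M.coeff i * s i + b ≠ 0 ∧
      ∀ k, ∑ i ∈ (DiffOp.toPoly (DiffOp.delta ^ k * (D * M))).support,
        (DiffOp.delta ^ k * (D * M)).coeff i * s i = -der k a := by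
    intro M hM
    set m := (DiffOp.toPoly M).natDegree with hm
    have hlc : M.coeff m ≠ 0 := Polynomial.leadingCoeff_ne_zero.2
      ((map_ne_zero_iff _ DiffOp.toPoly.injective).2 hM)
    have hd := fun k => DiffOp.delta_pow_mul_degree k _ (hmul M hM).1
    obtain ⟨s, h1, h2⟩ := DiffOp.exists_sum_coeff_mul_eq
      (fun k => DiffOp.delta ^ k * (D * M)) (DiffOp.toPoly (D * M)).natDegree
      (fun k => (hd k).1) (fun k h0 => by
        have := (hd k).2
        rw [h0, map_zero, Polynomial.leadingCoeff_zero, eq_comm, Polynomial.leadingCoeff_eq_zero,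
          map_eq_zero_iff _ DiffOp.toPoly.injective] at this
        exact (hmul M hM).1 this) (fun k => -der k a)
      -- Index `m` is below the order of `D * M`, so `s m` is free; this choice gives the sum
      -- including `b` the value `1`.
      (fun i => if i = m then (M.coeff m)⁻¹ * (1 - b) else 0)
    refine ⟨s, ?_, h2⟩
    rw [Finset.sum_eq_single m]
    · rw [h1 m (hmul M hM).2, if_pos rfl, mul_inv_cancel_left₀ hlc]
      simp
    · intro i hi hne
      have : i ≤ m := Polynomial.le_natDegree_of_mem_supp i hi
      rw [h1 i (lt_of_le_of_lt this (hmul M hM).2), if_neg hne, mul_zero]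
    · intro h0
      exact absurd (Polynomial.mem_support_iff.2 hlc) h0
  intro hmem
  rcases hM with hM | hM
  · obtain ⟨s, h1, h2⟩ := key M₁ hM
    -- Send `x^(i)` to `s i` and every `y^(i)` to `0`; the second case swaps the roles.
    have := map_eq_zero_of_mem_diffSpan
      (MvPolynomial.aeval fun v : Fin 2 × ℕ => if v.1 = 0 then s v.2 else 0)
      (fun k => by simp [der_linearDiffPoly, aeval_linearDiffPoly, h2]) hmem
    exact h1 (by simpa [aeval_linearDiffPoly] using this)
  · obtain ⟨s, h1, h2⟩ := key M₂ hM
    have := map_eq_zero_of_mem_diffSpan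
      (MvPolynomial.aeval fun v : Fin 2 × ℕ => if v.1 = 1 then s v.2 else 0)
      (fun k => by simp [der_linearDiffPoly, aeval_linearDiffPoly, h2]) hmem
    exact h1 (by simpa [aeval_linearDiffPoly] using this)

end Membership

/-! ### Necessity of a trivial gcld, and the explicit parametrization. -/

section Main

variable {F : Type*} {E : Type*} [Field F] [Differential F] [Field E] [Differential E]
  [Algebra F E]

theorem diffEval_linearDiffPoly (η : Fin 2 → E) (L₁ L₂ : DiffOp F) (a : F) :
    diffEval F η (linearDiffPoly L₁ L₂ a) =
      L₁.apply (η 0) + L₂.apply (η 1) + algebraMap F E a := by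
  rw [linearDiffPoly, map_add, map_add, diffEval, aeval_der_apply_X, aeval_der_apply_X,
    MvPolynomial.aeval_C]

variable [DifferentialAlgebra F E]

/-- A common left divisor of positive order obstructs unirationality. -/
theorem IsRationalParametrization.isGCLD [CharZero F] {R : Ranking (Fin 2)} {L₁ L₂ : DiffOp F}
    {a : F} (h0 : L₁ ≠ 0 ∨ L₂ ≠ 0) {u : E} {η : Fin 2 → E}
    (h : IsRationalParametrization R (linearDiffPoly L₁ L₂ a) u η) : DiffOp.IsGCLD L₁ L₂ 1 where
  monic := Polynomial.monic_one
  dvd_left := one_dvd _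
  dvd_right := one_dvd _
  degree_le := by
    rintro D ⟨M₁, rfl⟩ ⟨M₂, rfl⟩
    rw [DiffOp.degree_one]
    by_contra! hD
    have hM : M₁ ≠ 0 ∨ M₂ ≠ 0 :=
      h0.imp (fun h h' => h (by rw [h', mul_zero])) (fun h h' => h (by rw [h', mul_zero]))
    have hD0 : D ≠ 0 := by
      rintro rfl
      exact absurd hD (by rw [DiffOp.degree, map_zero, Polynomial.degree_zero]; simp)
    have hgen : vanishingIdeal F η = diffSpan {linearDiffPoly (D * M₁) (D * M₂) a} :=
      h.generic.trans (sat_eq_diffSpan R (totalDegree_linearDiffPoly_le _ _ _))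
    have hη : ∀ i, η i ∈ diffAdjoin F {u} := by
      intro i
      obtain ⟨P, Q, -, -, hi⟩ := h.rational i
      have := fun f => diffEval_mem_diffAdjoin (F := F) (fun _ : Unit => u) f
      rw [Set.range_const] at this
      rw [hi]
      exact div_mem (this P) (this Q)
    -- The curve equation at the point says that `w = M₁(x) + M₂(y)` solves `D w = -a` inside
    -- `F⟨u⟩`.
    have hw : D.apply (M₁.apply (η 0) + M₂.apply (η 1)) = algebraMap F E (-a) := by
      have : linearDiffPoly (D * M₁) (D * M₂) a ∈ vanishingIdeal F η := by
        rw [hgen]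
        exact Ideal.subset_span ⟨_, rfl, 0, rfl⟩
      have := RingHom.mem_ker.1 this
      rw [diffEval_linearDiffPoly, DiffOp.mul_apply, DiffOp.mul_apply,
        ← DiffOp.apply_map_add] at this
      rw [map_neg]
      exact eq_neg_of_add_eq_zero_left this
    obtain ⟨w, hw'⟩ := mem_range_of_apply_eq h.parameter
      (add_mem (apply_mem_diffAdjoin_of_mem (hη 0) _) (apply_mem_diffAdjoin_of_mem (hη 1) _)) hD0 hw
    refine linearDiffPoly_notMem_diffSpan hD hM a (-w) ?_
    rw [← hgen]
    refine RingHom.mem_ker.2 ?_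
    rw [diffEval_linearDiffPoly, ← hw', map_neg, add_neg_cancel]

theorem aeval_der_apply_X_add {σ K : Type*} [CommRing K] [Differential K] [Algebra F K]
    [DifferentialAlgebra F K] (η : σ → K) (k : ℕ) (L : DiffOp F) (j : σ) (b : F) :
    MvPolynomial.aeval (fun v : σ × ℕ => der v.2 (η v.1))
      (der k (L.apply (MvPolynomial.X (j, 0) : DiffPoly σ F) + algebraMap F (DiffPoly σ F) b)) =
        der k (L.apply (η j) + algebraMap F K b) := by
  rw [der_add, der_add, DiffOp.der_apply, DiffOp.der_apply, der_algebraMap, der_algebraMap,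
    map_add, aeval_der_apply_X, AlgHom.commutes]

section Unimodular

variable {L₁ L₂ A B A' B' X' Y' U V : DiffOp F} {a c : F}

/-- The cofactor matrix and its inverse act on pairs as mutually inverse maps. The algebra `K` is
left general because this is needed both in `E` and for the indeterminates of `F{x, y}`. -/
theorem DiffOp.IsUnimodular.apply_add_apply {K : Type*} [CommRing K] [Differential K] [Algebra F K]
    [DifferentialAlgebra F K] {R' R : DiffOp F}
    (h : DiffOp.IsUnimodular L₁ L₂ R' A' B' R A B X' Y' U V) (y z : K) :
    U.apply (A.apply y + A'.apply z) + V.apply (B.apply y + B'.apply z) = y ∧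
      X'.apply (A.apply y + A'.apply z) + Y'.apply (B.apply y + B'.apply z) = z ∧
      A.apply (U.apply y + V.apply z) + A'.apply (X'.apply y + Y'.apply z) = y ∧
      B.apply (U.apply y + V.apply z) + B'.apply (X'.apply y + Y'.apply z) = z := by
  have h1 := h.inv22 ▸ DiffOp.one_apply (F := F) y
  have h2 := h.inv21 ▸ DiffOp.zero_apply (F := F) z
  have h3 := h.inv12 ▸ DiffOp.zero_apply (F := F) y
  have h4 := h.inv11 ▸ DiffOp.one_apply (F := F) z
  have h5 := h.mul11 ▸ DiffOp.one_apply (F := F) y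
  have h6 := h.mul12 ▸ DiffOp.zero_apply (F := F) z
  have h7 := h.mul21 ▸ DiffOp.zero_apply (F := F) y
  have h8 := h.mul22 ▸ DiffOp.one_apply (F := F) z
  simp only [DiffOp.apply_add, DiffOp.mul_apply] at h1 h2 h3 h4 h5 h6 h7 h8
  simp only [DiffOp.apply_map_add]
  refine ⟨?_, ?_, ?_, ?_⟩
  · linear_combination h1 + h2
  · linear_combination h3 + h4
  · linear_combination h5 + h6
  · linear_combination h7 + h8

/-- With last remainder zero, `L₁ = c X'` and `L₂ = c Y'`: the equation involves only the first new
coordinate. -/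
theorem DiffOp.IsUnimodular.apply_add_apply_add (hc : c ≠ 0)
    (h : DiffOp.IsUnimodular L₁ L₂ (DiffOp.ofField c) A' B' 0 A B X' Y' U V) (η : Fin 2 → E) :
    L₁.apply (η 0) + L₂.apply (η 1) + algebraMap F E a =
      algebraMap F E c * (X'.apply (η 0) + Y'.apply (η 1) + algebraMap F E (a / c)) := by
  rw [h.eq_left, h.eq_right, zero_mul, zero_mul, add_zero, add_zero, DiffOp.mul_apply,
    DiffOp.mul_apply, DiffOp.ofField_apply, DiffOp.ofField_apply, mul_add, mul_add, ← map_mul,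
    mul_div_cancel₀ _ hc]

/-- The ideal of the point produced by the extended left Euclidean algorithm. -/
theorem DiffOp.IsUnimodular.vanishingIdeal_eq (hc : c ≠ 0)
    (h : DiffOp.IsUnimodular L₁ L₂ (DiffOp.ofField c) A' B' 0 A B X' Y' U V) {u : E}
    (hu : DiffTranscendental F u) :
    vanishingIdeal F ![A.apply u + algebraMap F E (A'.apply (-a / c)),
      B.apply u + algebraMap F E (B'.apply (-a / c))] = diffSpan {linearDiffPoly L₁ L₂ a} := by
  set η : Fin 2 → E := ![A.apply u + algebraMap F E (A'.apply (-a / c)),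
      B.apply u + algebraMap F E (B'.apply (-a / c))] with hη
  refine le_antisymm ?_ ?_
  -- `g` substitutes the parametrization, and `θ` substitutes `w`, the expression of the parameter
  -- in `x, y`. Modulo the ideal `θ ∘ g` is the identity, while `g f = 0` because `u` is
  -- differentially transcendental; hence `f` lies in the ideal.
  · intro f hf
    let x : DiffPoly (Fin 2) F := MvPolynomial.X (0, 0)
    let y : DiffPoly (Fin 2) F := MvPolynomial.X (1, 0)
    let t : DiffPoly Unit F := MvPolynomial.X ((), 0)
    let w : DiffPoly (Fin 2) F := U.apply x + V.apply y
    let z : DiffPoly (Fin 2) F := X'.apply x + Y'.apply y + algebraMap F _ (a / c)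
    let P : Fin 2 → DiffPoly Unit F := ![A.apply t + algebraMap F _ (A'.apply (-a / c)),
      B.apply t + algebraMap F _ (B'.apply (-a / c))]
    let Q : Fin 2 → DiffPoly (Fin 2) F := ![A.apply w + algebraMap F _ (A'.apply (-a / c)),
      B.apply w + algebraMap F _ (B'.apply (-a / c))]
    let g : DiffPoly (Fin 2) F →ₐ[F] DiffPoly Unit F :=
      MvPolynomial.aeval fun v => der v.2 (P v.1)
    let θ : DiffPoly Unit F →ₐ[F] DiffPoly (Fin 2) F :=
      MvPolynomial.aeval fun v => der v.2 w
    have hg : (diffEval F fun _ : Unit => u).comp g = diffEval F η := by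
      refine MvPolynomial.algHom_ext fun ⟨i, k⟩ => ?_
      rw [AlgHom.comp_apply, MvPolynomial.aeval_X, diffEval, diffEval, MvPolynomial.aeval_X]
      fin_cases i
      · exact aeval_der_apply_X_add (fun _ : Unit => u) k A () _
      · exact aeval_der_apply_X_add (fun _ : Unit => u) k B () _
    have hgf : g f = 0 := hu.diffEval_injective (by
      rw [map_zero]
      exact (DFunLike.congr_fun hg f).trans (RingHom.mem_ker.1 hf))
    have hz : linearDiffPoly L₁ L₂ a = (DiffOp.ofField c).apply z := by
      rw [linearDiffPoly, h.eq_left, h.eq_right, zero_mul, zero_mul, add_zero, add_zero,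
        DiffOp.mul_apply, DiffOp.mul_apply, DiffOp.apply_map_add, DiffOp.apply_map_add,
        DiffOp.ofField_apply c (algebraMap F _ (a / c)), ← map_mul, mul_div_cancel₀ _ hc]
      rfl
    have hz' : z = (DiffOp.ofField c⁻¹).apply (linearDiffPoly L₁ L₂ a) := by
      rw [hz, ← DiffOp.mul_apply, DiffOp.ofField_mul_ofField, inv_mul_cancel₀ hc,
        DiffOp.ofField_apply, map_one, one_mul]
    have hneg : ∀ L : DiffOp F, algebraMap F (DiffPoly (Fin 2) F) (L.apply (-a / c)) =
        L.apply 0 - L.apply (algebraMap F (DiffPoly (Fin 2) F) (a / c)) := by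
      intro L
      rw [← DiffOp.apply_map_sub, zero_sub, ← map_neg, DiffOp.apply_algebraMap, neg_div]
    -- Since `x = A w + A'(X' x + Y' y)`, the error of the substitution is `A' z`, and likewise `B'
    -- z` for `y`; `z` is `c⁻¹` times the generator.
    have hQ : ∀ i, ∃ L : DiffOp F, MvPolynomial.X (i, 0) - Q i = L.apply z := by
      intro i
      obtain ⟨-, -, h3, h4⟩ := h.apply_add_apply x y
      fin_cases i
      · refine ⟨A', ?_⟩
        change x - (A.apply w + algebraMap F _ (A'.apply (-a / c))) = _
        rw [hneg, DiffOp.apply_map_zero, DiffOp.apply_map_add A' _ (algebraMap F _ (a / c))]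
        linear_combination -h3
      · refine ⟨B', ?_⟩
        change y - (B.apply w + algebraMap F _ (B'.apply (-a / c))) = _
        rw [hneg, DiffOp.apply_map_zero, DiffOp.apply_map_add B' _ (algebraMap F _ (a / c))]
        linear_combination -h4
    have hθ : (Ideal.Quotient.mkₐ F (diffSpan {linearDiffPoly L₁ L₂ a})).comp (θ.comp g) =
        Ideal.Quotient.mkₐ F (diffSpan {linearDiffPoly L₁ L₂ a}) := by
      refine MvPolynomial.algHom_ext fun ⟨i, k⟩ => ?_
      have h1 : θ (g (MvPolynomial.X (i, k))) = der k (Q i) := by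
        rw [MvPolynomial.aeval_X]
        fin_cases i
        · exact aeval_der_apply_X_add (fun _ : Unit => w) k A () _
        · exact aeval_der_apply_X_add (fun _ : Unit => w) k B () _
      rw [AlgHom.comp_apply, AlgHom.comp_apply, h1, eq_comm, Ideal.Quotient.mkₐ_eq_mk,
        Ideal.Quotient.eq]
      obtain ⟨L, hL⟩ := hQ i
      have h2 : (MvPolynomial.X (i, k) : DiffPoly (Fin 2) F) = der k (MvPolynomial.X (i, 0)) := by
        rw [der_X, zero_add]
      rw [h2, ← der_sub, hL, hz', ← DiffOp.mul_apply]
      exact der_apply_mem_diffSpan _ _ _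
    have := DFunLike.congr_fun hθ f
    rw [AlgHom.comp_apply, AlgHom.comp_apply, hgf, map_zero, map_zero, eq_comm,
      Ideal.Quotient.mkₐ_eq_mk] at this
    exact Ideal.Quotient.eq_zero_iff_mem.1 this
  · intro f hf
    refine RingHom.mem_ker.2 (map_eq_zero_of_mem_diffSpan (diffEval F η) (fun k => ?_) hf)
    -- At the point the first new coordinate is `-a/c`, which solves `c z + a = 0`.
    have h0 : L₁.apply (η 0) + L₂.apply (η 1) + algebraMap F E a = 0 := by
      have h2 := (h.apply_add_apply u (algebraMap F E (-a / c))).2.1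
      rw [DiffOp.apply_algebraMap, DiffOp.apply_algebraMap] at h2
      rw [h.apply_add_apply_add hc]
      change _ * (X'.apply (A.apply u + _) + Y'.apply (B.apply u + _) + _) = 0
      rw [h2, ← map_add, ← add_div, neg_add_cancel, zero_div, map_zero, mul_zero]
    rw [der_linearDiffPoly, diffEval_linearDiffPoly, ← DiffOp.der_apply, ← DiffOp.der_apply,
      ← der_algebraMap, ← der_add, ← der_add, h0, der_zero_right]

theorem DiffOp.IsUnimodular.isProperLinearPolyParametrization (R : Ranking (Fin 2)) (hc : c ≠ 0)
    (h : DiffOp.IsUnimodular L₁ L₂ (DiffOp.ofField c) A' B' 0 A B X' Y' U V) {u : E}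
    (hu : DiffTranscendental F u) :
    IsProperLinearPolyParametrization R (linearDiffPoly L₁ L₂ a) u
      ![A.apply u + algebraMap F E (A'.apply (-a / c)),
        B.apply u + algebraMap F E (B'.apply (-a / c))] := by
  set η : Fin 2 → E := ![A.apply u + algebraMap F E (A'.apply (-a / c)),
      B.apply u + algebraMap F E (B'.apply (-a / c))] with hη
  have hlin : ∀ i, ∃ P : DiffPoly Unit F, P.totalDegree ≤ 1 ∧
      η i = diffEval F (fun _ => u) P := by
    have H : ∀ (L : DiffOp F) (b : F), ∃ P : DiffPoly Unit F, P.totalDegree ≤ 1 ∧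
        L.apply u + algebraMap F E b = diffEval F (fun _ => u) P := fun L b =>
      ⟨L.apply (MvPolynomial.X ((), 0)) + algebraMap F _ b,
        (MvPolynomial.totalDegree_add _ _).trans (max_le (totalDegree_apply_X_le _ _)
          (by simp [MvPolynomial.algebraMap_eq])),
        (aeval_der_apply_X_add (fun _ : Unit => u) 0 L () b).symm⟩
    intro i
    fin_cases i
    · exact H A _
    · exact H B _
  -- The second row of the inverse matrix recovers the parameter; properness and nonconstancy both
  -- rest on this.
  have hinv : U.apply (η 0) + V.apply (η 1) = u := by
    have h1 := (h.apply_add_apply u (algebraMap F E (-a / c))).1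
    rwa [DiffOp.apply_algebraMap, DiffOp.apply_algebraMap] at h1
  refine
    { parameter := hu
      rational := fun i => ?_
      generic := ?_
      proper := ?_
      linear := hlin
      nonconstant := ?_ }
  · obtain ⟨P, -, hP⟩ := hlin i
    exact ⟨P, 1, one_ne_zero, isRelPrime_one_right, by rw [map_one, div_one, hP]⟩
  · exact (h.vanishingIdeal_eq hc hu).trans
      (sat_eq_diffSpan R (totalDegree_linearDiffPoly_le _ _ _)).symm
  · refine le_antisymm (diffAdjoin_le_of_subset ?_) (diffAdjoin_le_of_subset ?_)
    · rintro _ ⟨i, rfl⟩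
      obtain ⟨P, -, hP⟩ := hlin i
      rw [hP]
      have := diffEval_mem_diffAdjoin (F := F) (fun _ : Unit => u) P
      rwa [Set.range_const] at this
    · rw [Set.singleton_subset_iff]
      have h1 := add_mem (apply_mem_diffAdjoin (Set.mem_range_self 0) U)
        (apply_mem_diffAdjoin (F := F) (Set.mem_range_self (f := η) 1) V)
      rwa [hinv] at h1
  · by_contra! hcon
    obtain ⟨b₀, h₀⟩ := hcon 0
    obtain ⟨b₁, h₁⟩ := hcon 1
    refine hu.notMem_range (U.apply b₀ + V.apply b₁) ?_
    rw [map_add, ← DiffOp.apply_algebraMap, ← DiffOp.apply_algebraMap, h₀, h₁, hinv]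

end Unimodular

end Main

end DiffAlg

end

/-! ### The theorem. -/

theorem mainTheorem4 {F : Type*} {E : Type*} [Field F] [CharZero F] [Differential F]
    [Field E] [Differential E] [Algebra F E] [DifferentialAlgebra F E]
    (hE : DiffAlg.IsUniversalExtension F E) (R : DiffAlg.Ranking (Fin 2))
    (L₁ L₂ : DiffAlg.DiffOp F) (a : F)
    (hF : ∀ c : F, DiffAlg.linearDiffPoly L₁ L₂ a ≠ MvPolynomial.C c) :
    (DiffAlg.IsUnirational E R (DiffAlg.linearDiffPoly L₁ L₂ a) ↔
      DiffAlg.DiffOp.IsGCLD L₁ L₂ 1) ∧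
    (DiffAlg.IsUnirational E R (DiffAlg.linearDiffPoly L₁ L₂ a) →
      (∃ (u : E) (η : Fin 2 → E), DiffAlg.IsProperLinearPolyParametrization R
        (DiffAlg.linearDiffPoly L₁ L₂ a) u η) ∧
      ∃ c : F, c ≠ 0 ∧ (DiffAlg.DiffOp.ele L₁ L₂).R = DiffAlg.DiffOp.ofField c ∧
        ∀ u : E, DiffAlg.DiffTranscendental F u →
          DiffAlg.IsProperLinearPolyParametrization R (DiffAlg.linearDiffPoly L₁ L₂ a) u
            (DiffAlg.eleParametrization (DiffAlg.DiffOp.ele L₁ L₂) a c u)) := by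
  have h0 : L₁ ≠ 0 ∨ L₂ ≠ 0 := by
    by_contra! h
    refine hF a ?_
    rw [DiffAlg.linearDiffPoly, h.1, h.2, DiffAlg.DiffOp.zero_apply, DiffAlg.DiffOp.zero_apply,
      zero_add, zero_add]
  have hgcld : DiffAlg.IsUnirational E R (DiffAlg.linearDiffPoly L₁ L₂ a) →
      DiffAlg.DiffOp.IsGCLD L₁ L₂ 1 := fun ⟨_, _, _, h⟩ => h.isGCLD h0
  have hparam : DiffAlg.DiffOp.IsGCLD L₁ L₂ 1 →
      ∃ c : F, c ≠ 0 ∧ (DiffAlg.DiffOp.ele L₁ L₂).R = DiffAlg.DiffOp.ofField c ∧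
        ∀ u : E, DiffAlg.DiffTranscendental F u →
          DiffAlg.IsProperLinearPolyParametrization R (DiffAlg.linearDiffPoly L₁ L₂ a) u
            (DiffAlg.eleParametrization (DiffAlg.DiffOp.ele L₁ L₂) a c u) := by
    intro hG
    obtain ⟨c, hc, hR⟩ := hG.exists_ele_eq_ofField h0
    obtain ⟨X', Y', X, Y, hM⟩ := DiffAlg.DiffOp.exists_isUnimodular_ele L₁ L₂
    rw [hR] at hM
    exact ⟨c, hc, hR, fun u hu => hM.isProperLinearPolyParametrization R hc hu⟩
  -- Universality of `E` supplies a parameter, turning the explicit formula into an existence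
  -- statement.
  obtain ⟨u, hu⟩ := hE.exists_diffTranscendental
  refine ⟨⟨hgcld, fun hG => ⟨?_, ?_⟩⟩, fun hU => ⟨?_, hparam (hgcld hU)⟩⟩
  · exact DiffAlg.irreducible_of_totalDegree_le_one
      (DiffAlg.totalDegree_linearDiffPoly_le _ _ _) hF
  · obtain ⟨c, -, -, h⟩ := hparam hG
    exact ⟨u, _, (h u hu).toIsRationalParametrization⟩
  · obtain ⟨c, -, -, h⟩ := hparam (hgcld hU)
    exact ⟨u, _, h u hu⟩
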